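/- Let $\lambda,r,\sigma^2,P>0$, $\alpha>2$, $0<\epsilon<1$, $0<\xi<1$, and let $N,B,k\ge 1$ be integers with $B\ge N$; put $c_N=Nk$. Let $R_t>\frac{\log_2 c_N}{2c_N}$, and let $\theta>0$ be the effective SINR threshold, i.e. the solution of $R_{N,\epsilon}(\theta)=R_t$, where $$R_{N,\epsilon}(\gamma)=\log_2(1+\gamma)+\frac{\log_2 c_N}{2c_N}-\frac{\log_2(e)\,Q^{-1}(\epsilon)}{\sqrt{c_N}}\sqrt{1-\frac1{(1+\gamma)^2}}$$ and $Q$ is the Gaussian $Q$-function. *Energy buffer.* Time is slotted and $\eta\in(0,1]$ is the update rate. In each slot, a source holding $\kappa\ge N$ energy units transmits a fresh packet with probability $\eta$, which consumes $N$ units; independently, one unit of energy arrives with probability $\xi$; units in excess of the capacity $B$ are discarded. A steady-state distribution of the buffer is a probability vector $S=(S_0,\dots,S_B)$ with $S\mathbf P=S$, where $\mathbf P$ is the transition matrix of $\kappa$ on $\{0,\dots,B\}$. *Network.* A typical link has its receiver at the origin and its source at distance $r$; the other sources form a homogeneous Poisson point process $\Phi=\{x_1,x_2,\dots\}$ of density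 $\lambda$ in the plane. The buffer of the typical source is empty at time $0$ and follows the dynamics above. In each slot the SINR at the typical receiver is $$\gamma=\frac{P h_0 r^{-\alpha}}{\sum_{j\ge1}P h_j v_j\|x_j\|^{-\alpha}+\sigma^2},$$ where the $h_j$ are exponential with mean $1$ and $v_j$ is the indicator that source $j$ has $\kappa_j\ge N$ and decides to update (with probability $\eta$), $\kappa_j$ having law $S$. Given $\Phi$, all these variables are independent of each other, over the slots (the network being in its steady state, the SINR is taken i.i.d. over time), and of the typical source's energy arrivals and update decisions. A transmission in the slot is received if $R_{N,\epsilon}(\gamma)>R_t$ and the codeword is decoded correctly, the latter having probability $1-\epsilon$ independently of everything else. The AoI of the typical link is $\Delta_0(t)=t-G_0(t)$, where $G_0(t)$ is the generation time of the latest packet received by time $t$ (a packet is generated at the beginning of the slot in which it is sent and received at the end of it). The network average AoI is $\bar\Delta=\mathbb E[\bar\Delta_0]$, where $\bar\Delta_0=\lim_{T\to\infty}\frac1T\sum_{t=1}^T\Delta_0(t)$ almost surely given $\Phi$. **Claim.** Let $\eta=1$. Then the buffer has exactly one steady-state distribution $S$, and $S_i=0$ for all $i>N$. The effective update rate is $\xi/N$: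 the activity probability $\eta\,\mathbb P(\kappa\ge N)=\eta\sum_{i=N}^B S_i$ equals $\xi/N$, and almost surely the fraction of slots in which the typical source transmits tends to $\xi/N$. For almost every $\Phi$ the limit $\bar\Delta_0$ exists almost surely and depends only on $\Phi$; it is integrable, and for every $B\ge N$ (so that any such $B$ acts like $B=N$) $$\bar\Delta=\frac{N}{\xi(1-\epsilon)}\exp\!\left(\frac{\sigma^2r^\alpha\theta}{P}+\frac{\lambda\,\Omega_N\,r^2\,\xi/N}{(1-\xi/N)^{1-2/\alpha}}\right)-\frac{N-1}{2\xi},\qquad \Omega_N=\frac{\pi\,\theta^{2/\alpha}}{\operatorname{sinc}(2/\alpha)},\quad \operatorname{sinc}z=\frac{\sin \pi z}{\pi z}.$$ -/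

import Mathlib

open MeasureTheory ProbabilityTheory Filter Topology

noncomputable section

namespace EHNetwork

/-- The plane carrying the positions of the nodes. -/
abbrev Plane : Type := EuclideanSpace ℝ (Fin 2)

/-- Parameters of the energy-harvesting random access network, with their standing ranges. -/
structure Params where
  /-- density of the source nodes -/
  lam : ℝ
  /-- distance between a source and its destination -/
  r : ℝ
  /-- path loss exponent -/
  α : ℝ
  /-- noise power -/
  σ2 : ℝ
  /-- transmission power -/
  P : ℝ
  /-- packet error rate -/
  ε : ℝ
  /-- target coding rate -/
  Rt : ℝ
  /-- energy arrival rate: probability of an energy arrival in a slot -/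
  ξ : unitInterval
  /-- update rate: probability that a source holding enough energy transmits in a slot -/
  η : unitInterval
  /-- energy units consumed per transmission -/
  N : ℕ
  /-- capacity of the energy buffers -/
  B : ℕ
  /-- codeword bits supported by one energy unit -/
  k : ℕ
  lam_pos : 0 < lam
  r_pos : 0 < r
  two_lt_α : 2 < α
  σ2_pos : 0 < σ2
  P_pos : 0 < P
  ε_pos : 0 < ε
  ε_lt_one : ε < 1
  ξ_pos : 0 < ξ
  ξ_lt_one : ξ < 1
  η_pos : 0 < η
  N_pos : 0 < N
  N_le_B : N ≤ B
  k_pos : 0 < k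

/-! ### Spatial model -/

/-- Number of the points `y 0, y 1, …` that lie in `A`. -/
def pointCount (y : ℕ → Plane) (A : Set Plane) : ℕ∞ := {i | y i ∈ A}.encard

/-- The random points `x 0, x 1, …` form a homogeneous Poisson point process of density `lam`:
the number of points in a set of finite area is Poisson with mean `lam` times the area, and the
numbers of points in finitely many disjoint such sets are independent. -/
structure IsHomogeneousPPP {Ω : Type*} [MeasurableSpace Ω] (μ : Measure Ω)
    (x : ℕ → Ω → Plane) (lam : ℝ) : Prop where
  measurable : ∀ i, Measurable (x i)
  count_law : ∀ A : Set Plane, MeasurableSet A → volume A ≠ ⊤ →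
    μ.map (fun ω => pointCount (fun i => x i ω) A)
      = (poissonMeasure (Real.toNNReal (lam * (volume A).toReal))).map (fun n : ℕ => (n : ℕ∞))
  count_indep : ∀ (n : ℕ) (A : Fin n → Set Plane), (∀ m, MeasurableSet (A m)) →
    (∀ m, volume (A m) ≠ ⊤) → Pairwise (fun m m' => Disjoint (A m) (A m')) →
    iIndepFun (fun m ω => pointCount (fun i => x i ω) (A m)) μ

/-! ### Finite blocklength coding -/

/-- The Gaussian `Q`-function `Q(y) = ℙ(Z > y)`, `Z` standard normal. -/
def gaussianQ (y : ℝ) : ℝ := (gaussianReal 0 1).real (Set.Ioi y)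

/-- The inverse of the Gaussian `Q`-function on `(0, 1)`. -/
def gaussianQInv (e : ℝ) : ℝ := sInf {y : ℝ | gaussianQ y ≤ e}

/-- The blocklength `c_N = N k`. -/
def Params.blocklength (p : Params) : ℝ := (p.N : ℝ) * (p.k : ℝ)

/-- The maximum coding rate `R_{N,ε}(γ)` at SINR `γ` (normal approximation). -/
def Params.codingRate (p : Params) (γ : ℝ) : ℝ :=
  Real.logb 2 (1 + γ) + Real.logb 2 p.blocklength / (2 * p.blocklength)
    - Real.logb 2 (Real.exp 1) * gaussianQInv p.ε / √p.blocklength * √(1 - 1 / (1 + γ) ^ 2)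

/-! ### Energy dynamics -/

/-- Buffer content in the next slot. With `u` the update decision and `a` the energy arrival of
the slot, a transmission (made when `u` holds and at least `N` units are stored) consumes `N`
units, an arrival adds one unit, and units beyond the capacity `B` are discarded. -/
def Params.nextEnergy (p : Params) (κ : Fin (p.B + 1)) (u a : Bool) : Fin (p.B + 1) :=
  ⟨min ((if p.N ≤ (κ : ℕ) ∧ u = true then (κ : ℕ) - p.N else (κ : ℕ))
      + (if a = true then 1 else 0)) p.B, Nat.lt_succ_of_le (min_le_right _ _)⟩

/-- Transition matrix of the energy buffer. -/
def Params.transition (p : Params) : Matrix (Fin (p.B + 1)) (Fin (p.B + 1)) ℝ :=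
  Matrix.of fun i j =>
    ((bernoulliMeasure true false p.η).prod (bernoulliMeasure true false p.ξ)).real
      {w | p.nextEnergy i w.1 w.2 = j}

/-- `S` is a steady-state distribution of the energy buffer: `S 𝐏 = S`. -/
def Params.IsSteadyState (p : Params) (S : PMF (Fin (p.B + 1))) : Prop :=
  Matrix.vecMul (fun i => (S i).toReal) p.transition = fun i => (S i).toReal

/-- The activity probability `η ℙ(κ ≥ N)` of a node in the steady state `S`. -/
def Params.activity (p : Params) (S : PMF (Fin (p.B + 1))) : ℝ :=
  (p.η : ℝ) * ∑ i : Fin (p.B + 1), if p.N ≤ (i : ℕ) then (S i).toReal else 0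

/-! ### Randomness of the slots, given the positions of the nodes -/

/-- Randomness of the typical link in a slot: energy arrival, update decision, outcome of the
decoder at an admissible rate, fading. -/
abbrev TypicalSlot : Type := Bool × Bool × Bool × ℝ

/-- Randomness of another link in a slot: fading towards the typical receiver, energy stored in
the buffer, update decision. -/
abbrev InterfererSlot (B : ℕ) : Type := ℝ × Fin (B + 1) × Bool

/-- Randomness of a slot. -/
abbrev Slot (B : ℕ) : Type := TypicalSlot × (ℕ → InterfererSlot B)

/-- Law of the typical link's randomness in a slot (independent coordinates). The decoder succeeds
with probability `1 - ε`. -/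
def Params.typicalLaw (p : Params) : Measure TypicalSlot :=
  (bernoulliMeasure true false p.ξ).prod ((bernoulliMeasure true false p.η).prod
    ((bernoulliMeasure true false
      (⟨1 - p.ε, by linarith [p.ε_lt_one], by linarith [p.ε_pos]⟩ : unitInterval)).prod
        (expMeasure 1)))

/-- Law of another link's randomness in a slot: unit-mean exponential fading, a buffer in the
steady state `S`, and an update with probability `η`, all independent. -/
def Params.interfererLaw (p : Params) (S : PMF (Fin (p.B + 1))) :
    Measure (InterfererSlot p.B) :=
  (expMeasure 1).prod (S.toMeasure.prod (bernoulliMeasure true false p.η))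

/-- Law of the randomness of all slots: independent over the links and, the SINR being taken
i.i.d. over time in the steady state of the network, independent over the slots. -/
def Params.slotsLaw (p : Params) (S : PMF (Fin (p.B + 1))) : Measure (ℕ → Slot p.B) :=
  Measure.infinitePi fun _ : ℕ =>
    p.typicalLaw.prod (Measure.infinitePi fun _ : ℕ => p.interfererLaw S)

/-! ### The typical link -/

/-- Energy stored at the typical source at the beginning of slot `t`; the buffer is empty at
time `0`. -/
def Params.energy (p : Params) (s : ℕ → Slot p.B) : ℕ → Fin (p.B + 1)
  | 0 => 0
  | t + 1 => p.nextEnergy (p.energy s t) (s t).1.2.1 (s t).1.1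

/-- The typical source transmits a fresh packet in slot `t`. -/
def Params.Attempt (p : Params) (s : ℕ → Slot p.B) (t : ℕ) : Prop :=
  p.N ≤ (p.energy s t : ℕ) ∧ (s t).1.2.1 = true

open Classical in
/-- Interference at the typical receiver, the other sources being at `y 0, y 1, …`: the source `j`
contributes `P h_j ‖y_j‖^{-α}` if it is active (has at least `N` energy units and updates). -/
def Params.interference (p : Params) (y : ℕ → Plane) (w : ℕ → InterfererSlot p.B) : ENNReal :=
  ∑' j, if p.N ≤ ((w j).2.1 : ℕ) ∧ (w j).2.2 = true then
    ENNReal.ofReal (p.P * (w j).1 * ‖y j‖ ^ (-p.α)) else 0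

/-- SINR at the typical receiver (zero if the interference is infinite). -/
def Params.sinr (p : Params) (y : ℕ → Plane) (w : Slot p.B) : ℝ :=
  (ENNReal.ofReal (p.P * w.1.2.2.2 * p.r ^ (-p.α))
    / (p.interference y w.2 + ENNReal.ofReal p.σ2)).toReal

/-- The typical source transmits in slot `t` and its packet is received: the maximum coding rate
exceeds the target rate and the codeword is decoded correctly. -/
def Params.Success (p : Params) (y : ℕ → Plane) (s : ℕ → Slot p.B) (t : ℕ) : Prop :=
  p.Attempt s t ∧ p.Rt < p.codingRate (p.sinr y (s t)) ∧ (s t).1.2.2.1 = true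

open Classical in
/-- Generation time `G₀(t)` of the latest packet received by time `t`. A packet is generated at
the beginning of the slot in which it is sent, and its transmission takes that slot. -/
def Params.lastGeneration (p : Params) (y : ℕ → Plane) (s : ℕ → Slot p.B) : ℕ → ℕ
  | 0 => 0
  | t + 1 => if p.Success y s t then t else p.lastGeneration y s t

/-- Age of information `Δ₀(t) = t - G₀(t)` of the typical link. -/
def Params.age (p : Params) (y : ℕ → Plane) (s : ℕ → Slot p.B) (t : ℕ) : ℝ :=
  (t : ℝ) - (p.lastGeneration y s t : ℝ)

/-- `D` is the network average AoI: given the positions of the nodes, the time average of the AoI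
of the typical link converges almost surely, and `D` is the expectation of the limit. -/
def Params.IsNetworkAverageAoI (p : Params) (S : PMF (Fin (p.B + 1))) {Ω : Type*}
    [MeasurableSpace Ω] (μ : Measure Ω) (x : ℕ → Ω → Plane) (D : ℝ) : Prop :=
  ∃ Δbar : Ω → ℝ,
    (∀ᵐ ω ∂μ, ∀ᵐ s ∂(p.slotsLaw S),
      Tendsto (fun T : ℕ => (∑ t ∈ Finset.Icc 1 T, p.age (fun i => x i ω) s t) / (T : ℝ))
        atTop (𝓝 (Δbar ω))) ∧
    Integrable Δbar μ ∧ ∫ ω, Δbar ω ∂μ = D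

open Classical in
/-- `ρ` is the update frequency of the typical source: almost surely, the fraction of the slots
in which it transmits converges to `ρ`. -/
def Params.IsUpdateFrequency (p : Params) (S : PMF (Fin (p.B + 1))) (ρ : ℝ) : Prop :=
  ∀ᵐ s ∂(p.slotsLaw S),
    Tendsto (fun T : ℕ => (((Finset.Icc 1 T).filter fun t => p.Attempt s t).card : ℝ) / (T : ℝ))
      atTop (𝓝 ρ)

/-- `Ω_N = π θ^{2/α} / sinc(2/α)` with the normalized `sinc z = sin (π z) / (π z)`. -/
def Params.bigOmega (p : Params) (θ : ℝ) : ℝ :=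
  Real.pi * θ ^ (2 / p.α) / Real.sinc (Real.pi * (2 / p.α))

end EHNetwork

end

open MeasureTheory ProbabilityTheory Filter Topology

noncomputable section

namespace EHNetwork
/-! ### The rate condition as a threshold condition -/

/-! With `η = 1` a source transmits as soon as it holds `N` units, so starting from an empty buffer
it never holds more. Balance of probability flow forces the steady state: mass `(1 - ξ)/N` at `0`,
`1/N` strictly between `0` and `N`, `ξ/N` at `N`, nothing above. Hence each interferer is active
with probability `ξ/N`, whatever `B ≥ N` is.

Fix the positions of the nodes. Since the coding rate exceeds the target exactly when the SINR
exceeds `θ` (`Params.lt_codingRate_iff`), each transmission succeeds independently with one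
probability `q`. Exponential fading makes `q` a Laplace transform of noise plus interference: `q =
(1 - ε) exp(-σ²r^αθ/P) / F`, where `F` is the product over the interferers of `1 + g(x_j)`, with `g`
the function `Params.interferenceWeight` (`Params.restLaw_goodSet`).

The pair (energy, age) is then a Markov chain driven by i.i.d. marks (arrival, success). Its average
age is `N/(ξq) - (N-1)/(2ξ)`. Instead of a renewal argument, an explicit solution `V` of the Poisson
equation `f - D + PV = V`, with `P` the transition operator, turns the centred partial sums into a
martingale up to a correction `V`. A Lyapunov function bounds the second moment of the age, so these
sums have second moment of order `T`. This gives almost sure convergence along the squares, and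
positivity of `f` fills the gaps (`IsMarkSequence.tendsto_average`).

The limit is affine in `1/q`, hence in `F`. Averaging over the nodes therefore needs only `E F =
exp(λ ∫ g)`, the Poisson generating functional at a function at least one
(`IsHomogeneousPPP.lintegral_prodOneAdd`). The integral of `g` is computed in polar coordinates
through Gamma integrals and the reflection formula. Finiteness of `E F` also shows `q > 0` for
almost every configuration. -/

theorem sq_log_mul_le {u v : ℝ} (hu : 0 < u) (huv : u ≤ v) :
    u ^ 2 * (1 - Real.exp (-(2 * v))) ≤ v ^ 2 * (1 - Real.exp (-(2 * u))) := by
  have hv : 0 < v := hu.trans_le huv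
  have ht : u / v ≤ 1 := (div_le_one hv).2 huv
  -- Convexity of exp, with `-2u` on the segment from `-2v` to `0`, says that `(1 - exp(-2u))/u`
  -- decreases in `u`; a further factor `u ≤ v` gives the squares.
  have hc := convexOn_exp.2 (Set.mem_univ (-(2 * v))) (Set.mem_univ 0)
    (div_nonneg hu.le hv.le) (sub_nonneg.2 ht) (by ring)
  have he : (u / v) • (-(2 * v)) + (1 - u / v) • (0 : ℝ) = -(2 * u) := by
    simp only [smul_eq_mul]; field_simp; ring
  rw [he] at hc
  simp only [smul_eq_mul, Real.exp_zero, mul_one] at hc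
  have h1 : 0 ≤ 1 - Real.exp (-(2 * v)) := by
    rw [sub_nonneg, Real.exp_le_one_iff]; linarith
  have h2 : u / v * (1 - Real.exp (-(2 * v))) ≤ 1 - Real.exp (-(2 * u)) := by linarith
  have h3 : u * (1 - Real.exp (-(2 * v))) ≤ v * (1 - Real.exp (-(2 * u))) := by
    have := mul_le_mul_of_nonneg_left h2 hv.le
    rwa [← mul_assoc, mul_div_cancel₀ _ hv.ne'] at this
  have h4 : 0 ≤ v * (1 - Real.exp (-(2 * u))) := (mul_nonneg hu.le h1).trans h3
  calc u ^ 2 * (1 - Real.exp (-(2 * v))) = u * (u * (1 - Real.exp (-(2 * v)))) := by ring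
    _ ≤ v * (v * (1 - Real.exp (-(2 * u)))) := mul_le_mul huv h3 (mul_nonneg hu.le h1) hv.le
    _ = _ := by ring

theorem one_sub_inv_sq_eq {x : ℝ} (hx : 0 ≤ x) :
    1 - 1 / (1 + x) ^ 2 = 1 - Real.exp (-(2 * Real.log (1 + x))) := by
  have h : (0 : ℝ) < 1 + x := by linarith
  rw [Real.exp_neg, mul_comm, Real.exp_mul, Real.exp_log h]
  norm_num

/-- In the variable `u = log (1 + x)` the dispersion is `1 - exp(-2u)`, and squaring reduces the
claim to `sq_log_mul_le`. It makes dispersion root over logarithm a decreasing ratio, which replaces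
monotonicity of the coding rate: for a positive back-off the rate may decrease near `0`. -/
theorem log_mul_sqrt_le {x y : ℝ} (hx : 0 < x) (hxy : x ≤ y) :
    Real.log (1 + x) * √(1 - 1 / (1 + y) ^ 2) ≤ Real.log (1 + y) * √(1 - 1 / (1 + x) ^ 2) := by
  have hu : 0 < Real.log (1 + x) := Real.log_pos (by linarith)
  have huv : Real.log (1 + x) ≤ Real.log (1 + y) := Real.log_le_log (by linarith) (by linarith)
  have hv := hu.trans_le huv
  rw [one_sub_inv_sq_eq hx.le, one_sub_inv_sq_eq (hx.le.trans hxy)]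
  rw [← Real.sqrt_sq hu.le, ← Real.sqrt_sq hv.le, ← Real.sqrt_mul (sq_nonneg _),
    ← Real.sqrt_mul (sq_nonneg _), Real.sqrt_sq hu.le, Real.sqrt_sq hv.le]
  exact Real.sqrt_le_sqrt (sq_log_mul_le hu huv)

/-- The coding rate exceeds the target exactly at SINRs above the effective threshold. -/
theorem Params.lt_codingRate_iff (p : Params)
    (hRt : Real.logb 2 p.blocklength / (2 * p.blocklength) < p.Rt)
    {θ : ℝ} (hθ : 0 < θ) (hθR : p.codingRate θ = p.Rt) {γ : ℝ} (hγ : 0 ≤ γ) :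
    p.Rt < p.codingRate γ ↔ θ < γ := by
  set K := Real.logb 2 (Real.exp 1) * gaussianQInv p.ε / √p.blocklength with hK
  set d := Real.logb 2 p.blocklength / (2 * p.blocklength) with hd
  have hR : ∀ x, p.codingRate x = Real.log (1 + x) / Real.log 2 + d
      - K * √(1 - 1 / (1 + x) ^ 2) := fun x => by
    rw [Params.codingRate, ← hd, ← hK, Real.logb]
  have hL : 0 < Real.log 2 := Real.log_pos (by norm_num)
  have hmono : ∀ {x y : ℝ}, 0 ≤ x → x < y → Real.log (1 + x) < Real.log (1 + y) :=
    fun hx hxy => Real.log_lt_log (by linarith) (by linarith)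
  rw [← hθR] at hRt ⊢
  have hw : 0 < Real.log (1 + θ) := Real.log_pos (by linarith)
  -- The sign of `K` is that of `Q⁻¹(ε)`. If `K ≥ 0`, only `(R(x) - d)/log(1+x)` is known to be
  -- monotone; this suffices because `R(θ) - d > 0`, which is what the lower bound on `Rt` provides.
  -- If `K < 0`, the rate itself is strictly increasing.
  rcases le_or_gt 0 K with hK0 | hK0
  · have key : ∀ {x y : ℝ}, 0 < x → x ≤ y → (p.codingRate x - d) * Real.log (1 + y) ≤
        (p.codingRate y - d) * Real.log (1 + x) := by
      intro x y hx hxy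
      have := mul_le_mul_of_nonneg_left (log_mul_sqrt_le hx hxy) hK0
      rw [hR, hR]
      have e : Real.log (1 + x) / Real.log 2 * Real.log (1 + y)
        = Real.log (1 + y) / Real.log 2 * Real.log (1 + x) := by ring
      nlinarith
    have hc : 0 < p.codingRate θ - d := by linarith
    constructor
    · intro h
      by_contra! hle
      rcases hγ.eq_or_lt with h0 | h0
      · rw [← h0, hR 0] at h
        norm_num at h
        linarith
      · have h1 := key h0 hle
        have h2 : Real.log (1 + γ) ≤ Real.log (1 + θ) :=
          Real.log_le_log (by linarith) (by linarith)
        have h3 := mul_le_mul_of_nonneg_left h2 hc.le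
        have h4 := le_of_mul_le_mul_right (h1.trans h3) hw
        linarith
    · intro h
      have h1 := key hθ h.le
      have h2 := mul_lt_mul_of_pos_left (hmono hθ.le h) hc
      have h3 := lt_of_mul_lt_mul_right (h2.trans_le h1) hw.le
      linarith
  · have key : ∀ {x y : ℝ}, 0 ≤ x → x < y → p.codingRate x < p.codingRate y := by
      intro x y hx hxy
      rw [hR, hR]
      have h1 := div_lt_div_of_pos_right (hmono hx hxy) hL
      have h2 : √(1 - 1 / (1 + x) ^ 2) ≤ √(1 - 1 / (1 + y) ^ 2) := by
        apply Real.sqrt_le_sqrt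
        have : 1 / (1 + y) ^ 2 ≤ 1 / (1 + x) ^ 2 := by
          apply one_div_le_one_div_of_le (by positivity)
          gcongr
        linarith
      have h3 := mul_le_mul_of_nonpos_left h2 hK0.le
      linarith
    constructor
    · intro h
      by_contra! hle
      rcases hle.eq_or_lt with h0 | h0
      · rw [h0] at h; exact lt_irrefl _ h
      · exact lt_asymm h (key hγ h0)
    · exact key hθ.le

/-! ### The steady state of the energy buffer -/

theorem Params.ξ_real_pos (p : Params) : (0 : ℝ) < p.ξ := p.ξ_pos

theorem Params.ξ_real_lt_one (p : Params) : (p.ξ : ℝ) < 1 := p.ξ_lt_one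

theorem Params.N_real_pos (p : Params) : (0 : ℝ) < p.N := Nat.cast_pos.2 p.N_pos

/-- With update rate one a state `i` moves to `nextEnergy i true true` with probability `ξ` and to
`nextEnergy i true false` with probability `1 - ξ`. -/
theorem Params.transition_eq (p : Params) (hη : p.η = 1) (i j : Fin (p.B + 1)) :
    p.transition i j = (p.ξ : ℝ) * (if p.nextEnergy i true true = j then 1 else 0)
      + (1 - p.ξ) * (if p.nextEnergy i true false = j then 1 else 0) := by
  classical
  simp only [Params.transition, Matrix.of_apply, hη, bernoulliMeasure_one]
  rw [measureReal_def, Measure.dirac_prod, Measure.map_apply (by fun_prop) (.of_discrete),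
    ← measureReal_def, bernoulliMeasure_real_apply _ (.of_discrete)]
  simp only [Set.mem_preimage, Set.mem_ofPred_eq]
  split_ifs <;> simp

/-- Invariance of a steady state, tested against functions. -/
theorem Params.isSteadyState_iff (p : Params) (hη : p.η = 1) (S : PMF (Fin (p.B + 1))) :
    p.IsSteadyState S ↔ ∀ f : Fin (p.B + 1) → ℝ, ∑ i, (S i).toReal * f i =
      ∑ i, (S i).toReal * (p.ξ * f (p.nextEnergy i true true)
        + (1 - p.ξ) * f (p.nextEnergy i true false)) := by
  have hv : ∀ j, Matrix.vecMul (fun i => (S i).toReal) p.transition j =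
      ∑ i, (S i).toReal * (p.ξ * (if p.nextEnergy i true true = j then 1 else 0)
        + (1 - p.ξ) * (if p.nextEnergy i true false = j then 1 else 0)) := by
    intro j
    simp only [Matrix.vecMul, dotProduct, p.transition_eq hη]
  constructor
  · intro h f
    have h' : ∀ j, (S j).toReal = _ := fun j => (congrFun h j).symm.trans (hv j)
    calc ∑ j, (S j).toReal * f j
        = ∑ j, (∑ i, (S i).toReal * (p.ξ * (if p.nextEnergy i true true = j then 1 else 0)
        + (1 - p.ξ) * (if p.nextEnergy i true false = j then 1 else 0))) * f j :=
          Finset.sum_congr rfl fun j _ => by rw [← h' j]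
      _ = _ := by
          simp_rw [Finset.sum_mul]
          rw [Finset.sum_comm]
          refine Finset.sum_congr rfl fun i _ => ?_
          have : ∀ a : Fin (p.B + 1), f a = ∑ j, (if a = j then 1 else 0) * f j := by simp
          rw [this (p.nextEnergy i true true), this (p.nextEnergy i true false),
            Finset.mul_sum, Finset.mul_sum, ← Finset.sum_add_distrib, Finset.mul_sum]
          exact Finset.sum_congr rfl fun j _ => by ring
  · intro h
    funext j
    have := h (fun i => if i = j then 1 else 0)
    rw [hv, ← this]
    simp

theorem Params.nextEnergy_val_of_lt (p : Params) {i : Fin (p.B + 1)} (hi : (i : ℕ) < p.N)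
    (u a : Bool) : (p.nextEnergy i u a : ℕ) = i + (if a = true then 1 else 0) := by
  have := p.N_le_B
  simp only [Params.nextEnergy]
  split_ifs <;> omega

theorem Params.nextEnergy_val_of_le (p : Params) {i : Fin (p.B + 1)} (hi : p.N ≤ (i : ℕ))
    (a : Bool) : (p.nextEnergy i true a : ℕ) = i - p.N + (if a = true then 1 else 0) := by
  have := p.N_le_B
  have := p.N_pos
  have := i.2
  simp only [Params.nextEnergy]
  split_ifs <;> simp_all <;> omega

/-- The steady state of the buffer at update rate one. -/
def Params.steady (p : Params) (i : ℕ) : ℝ :=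
  if i = 0 then (1 - p.ξ) / p.N else if i < p.N then 1 / p.N
    else if i = p.N then p.ξ / p.N else 0

theorem Params.steady_nonneg (p : Params) (i : ℕ) : 0 ≤ p.steady i := by
  have := p.ξ_real_pos
  have := p.ξ_real_lt_one
  have := p.N_real_pos
  unfold Params.steady
  split_ifs
  · exact div_nonneg (by linarith) this.le
  · positivity
  · positivity
  · rfl

theorem Params.sum_fin_eq (p : Params) {f : ℕ → ℝ} (hf : ∀ i, p.N < i → f i = 0) :
    ∑ i : Fin (p.B + 1), f i = ∑ i ∈ Finset.range p.N, f i + f p.N := by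
  rw [Fin.sum_univ_eq_sum_range, ← Finset.sum_range_succ]
  symm
  apply Finset.sum_subset
  · intro i hi
    have := p.N_le_B
    simp only [Finset.mem_range] at hi ⊢
    omega
  · intro i _ hi
    simp only [Finset.mem_range] at hi
    exact hf i (by omega)

theorem Params.steady_eq_zero (p : Params) {i : ℕ} (hi : p.N < i) : p.steady i = 0 := by
  unfold Params.steady
  rw [if_neg (by omega), if_neg (by omega), if_neg (by omega)]

theorem Params.sum_steady (p : Params) : ∑ i : Fin (p.B + 1), p.steady i = 1 := by
  rw [p.sum_fin_eq fun i => p.steady_eq_zero]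
  obtain ⟨n, hn⟩ : ∃ n, p.N = n + 1 := ⟨p.N - 1, by have := p.N_pos; omega⟩
  have hN := p.N_real_pos
  have h1 : ∀ i ∈ Finset.range n, p.steady (i + 1) = 1 / p.N := fun i hi => by
    have := Finset.mem_range.1 hi
    unfold Params.steady
    rw [if_neg (by omega), if_pos (by omega)]
  have h2 : p.steady p.N = p.ξ / p.N := by
    unfold Params.steady
    rw [if_neg (by omega), if_neg (by omega), if_pos rfl]
  have h3 : p.steady 0 = (1 - p.ξ) / p.N := by simp [Params.steady]
  have h4 : ∑ i ∈ Finset.range p.N, p.steady i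
      = ∑ i ∈ Finset.range n, 1 / (p.N : ℝ) + (1 - p.ξ) / p.N := by
    rw [← Finset.sum_congr rfl h1, ← h3, ← Finset.sum_range_succ', hn]
  rw [h2, h4]
  have : (p.N : ℝ) = n + 1 := by rw [hn]; push_cast; ring
  simp only [Finset.sum_const, Finset.card_range, nsmul_eq_mul]
  field_simp
  linarith

/-- The steady state as a probability mass function. -/
def Params.steadyPMF (p : Params) : PMF (Fin (p.B + 1)) :=
  PMF.ofFintype (fun i => ENNReal.ofReal (p.steady i)) (by
    rw [← ENNReal.ofReal_sum_of_nonneg fun (i : Fin (p.B + 1)) _ => p.steady_nonneg i, p.sum_steady]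
    simp)

theorem Params.steadyPMF_toReal (p : Params) (i : Fin (p.B + 1)) :
    (p.steadyPMF i).toReal = p.steady i := by
  simp [Params.steadyPMF, ENNReal.toReal_ofReal (p.steady_nonneg i)]

theorem Params.isSteadyState_steadyPMF (p : Params) (hη : p.η = 1) :
    p.IsSteadyState p.steadyPMF := by
  rw [p.isSteadyState_iff hη]
  intro f
  have hB := p.N_le_B
  -- Extending `f` by zero to all naturals lets the shift by one unit be a reindexing of sums over
  -- ranges.
  set g : ℕ → ℝ := fun i => if h : i < p.B + 1 then f ⟨i, h⟩ else 0
  have hfg : ∀ i : Fin (p.B + 1), f i = g i := fun i => by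
    change f i = if h : (i : ℕ) < p.B + 1 then f ⟨i, h⟩ else 0
    rw [dif_pos i.2]
  obtain ⟨n, hn⟩ : ∃ n, p.N = n + 1 := ⟨p.N - 1, by have := p.N_pos; omega⟩
  have hN := p.N_real_pos
  have hsN : p.steady p.N = p.ξ / p.N := by
    unfold Params.steady
    rw [if_neg (by omega), if_neg (by omega), if_pos rfl]
  have hs0 : p.steady 0 = (1 - p.ξ) / p.N := by simp [Params.steady]
  have h1 : ∀ i ∈ Finset.range n, p.steady (i + 1) = 1 / p.N := fun i hi => by
    have := Finset.mem_range.1 hi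
    unfold Params.steady
    rw [if_neg (by omega), if_pos (by omega)]
  have hR : ∑ i, (p.steadyPMF i).toReal * (p.ξ * f (p.nextEnergy i true true)
        + (1 - p.ξ) * f (p.nextEnergy i true false)) =
      ∑ i : Fin (p.B + 1), p.steady i * (if (i : ℕ) < p.N then p.ξ * g (i + 1) + (1 - p.ξ) * g i
        else p.ξ * g 1 + (1 - p.ξ) * g 0) := by
    refine Finset.sum_congr rfl fun i _ => ?_
    rw [p.steadyPMF_toReal, hfg, hfg]
    split_ifs with hi
    · simp [p.nextEnergy_val_of_lt hi]
    · rcases (not_lt.1 hi).eq_or_lt with h | h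
      · simp [p.nextEnergy_val_of_le h.le, ← h]
      · simp [p.steady_eq_zero h]
  have hLh : ∑ i, (p.steadyPMF i).toReal * f i = ∑ i : Fin (p.B + 1), p.steady i * g i :=
    Finset.sum_congr rfl fun i _ => by rw [p.steadyPMF_toReal, hfg]
  rw [hR, hLh, p.sum_fin_eq (f := fun i => p.steady i * g i) fun i hi => by
      simp [p.steady_eq_zero hi],
    p.sum_fin_eq (f := fun i => p.steady i * (if i < p.N then (p.ξ : ℝ) * g (i + 1) + (1 - p.ξ) * g i
        else p.ξ * g 1 + (1 - p.ξ) * g 0)) fun i hi => by simp [p.steady_eq_zero hi]]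
  rw [if_neg (lt_irrefl _), hsN]
  have e1 : ∑ i ∈ Finset.range p.N, p.steady i * g i =
      ∑ i ∈ Finset.range n, 1 / p.N * g (i + 1) + (1 - p.ξ) / p.N * g 0 := by
    conv_lhs => rw [hn, Finset.sum_range_succ', hs0]
    congr 1
    exact Finset.sum_congr rfl fun i hi => by rw [h1 i hi]
  have e2 : ∑ i ∈ Finset.range p.N, p.steady i *
        (if i < p.N then (p.ξ : ℝ) * g (i + 1) + (1 - p.ξ) * g i
          else (p.ξ : ℝ) * g 1 + (1 - p.ξ) * g 0) =
      ∑ i ∈ Finset.range n, 1 / (p.N : ℝ) * (p.ξ * g (i + 1 + 1) + (1 - p.ξ) * g (i + 1))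
        + (1 - p.ξ) / p.N * (p.ξ * g 1 + (1 - p.ξ) * g 0) := by
    conv_lhs => rw [hn, Finset.sum_range_succ', hs0]
    rw [if_pos (by omega)]
    congr 1
    refine Finset.sum_congr rfl fun i hi => ?_
    rw [h1 i hi, if_pos (by have := Finset.mem_range.1 hi; omega)]
  have e3 : ∑ i ∈ Finset.range n, g (i + 1 + 1) + g 1 =
      ∑ i ∈ Finset.range n, g (i + 1) + g p.N := by
    rw [hn, ← Finset.sum_range_succ (fun i => g (i + 1)),
      ← Finset.sum_range_succ' (fun i => g (i + 1))]
  rw [e1, e2]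
  simp only [← Finset.mul_sum, Finset.sum_add_distrib]
  have e4 : ∑ i ∈ Finset.range n, g (i + 1 + 1) =
      ∑ i ∈ Finset.range n, g (i + 1) + g p.N - g 1 := by linarith
  rw [e4]
  field_simp
  ring

/-- Downward induction from `B`. A state `i > N` cannot be entered from below; it is kept only if `N
= 1` and a unit arrives, and the states above it carry no mass. So `S i ≤ ξ * S i`, and `ξ < 1`. -/
theorem Params.IsSteadyState.eq_zero_of_lt {p : Params} (hη : p.η = 1)
    {S : PMF (Fin (p.B + 1))} (hS : p.IsSteadyState S) (i : Fin (p.B + 1))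
    (hi : p.N < (i : ℕ)) : (S i).toReal = 0 := by
  rw [p.isSteadyState_iff hη] at hS
  have hN := p.N_pos
  induction hd : p.B - i using Nat.strong_induction_on generalizing i with
  | _ d ih =>
    have h := hS (fun j => if j = i then 1 else 0)
    have hle : ∑ j, (S j).toReal * (p.ξ * (if p.nextEnergy j true true = i then 1 else 0)
        + (1 - p.ξ) * (if p.nextEnergy j true false = i then 1 else 0)) ≤
        ∑ j, (if j = i then (S j).toReal * p.ξ else 0) := by
      refine Finset.sum_le_sum fun j _ => ?_
      rcases lt_trichotomy (j : ℕ) i with hj | hj | hj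
      · have h1 : ∀ a, p.nextEnergy j true a ≠ i := fun a ha => by
          have ha' := congrArg Fin.val ha
          rcases lt_or_ge (j : ℕ) p.N with hjN | hjN
          · rw [p.nextEnergy_val_of_lt hjN] at ha'; split_ifs at ha' <;> omega
          · rw [p.nextEnergy_val_of_le hjN] at ha'; split_ifs at ha' <;> omega
        rw [if_neg (h1 _), if_neg (h1 _), if_neg (fun h => by simp [h] at hj)]
        simp
      · have hji : j = i := Fin.ext hj
        subst hji
        have h1 : p.nextEnergy j true false ≠ j := fun ha => by
          have ha' := congrArg Fin.val ha
          rw [p.nextEnergy_val_of_le hi.le] at ha'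
          simp at ha'
          omega
        rw [if_neg h1, if_pos rfl]
        have := p.ξ_real_pos
        split_ifs <;> simp
        positivity
      · rw [ih (p.B - j) (by have := j.2; omega) j (hi.trans hj) rfl]
        simp
    rw [← h] at hle
    simp only [mul_ite, mul_one, mul_zero, Finset.sum_ite_eq', Finset.mem_univ, if_true] at hle
    have := p.ξ_real_lt_one
    have h0 : 0 ≤ (S i).toReal := ENNReal.toReal_nonneg
    nlinarith

theorem sum_toReal_pmf {n : ℕ} (S : PMF (Fin n)) : ∑ i, (S i).toReal = 1 := by
  rw [← ENNReal.toReal_sum fun i _ => S.apply_ne_top i, ← tsum_fintype (L := .unconditional _),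
    S.tsum_coe, ENNReal.toReal_one]

/-- In a steady state, the flow upwards into `{m, m + 1, …}` balances the flow out of it. -/
theorem Params.IsSteadyState.flow {p : Params} (hη : p.η = 1)
    {S : PMF (Fin (p.B + 1))} (hS : p.IsSteadyState S) {m : ℕ} (hm : m < p.N) :
    p.ξ * (S ⟨m, by have := p.N_le_B; omega⟩).toReal =
      (if m = 0 then 1 - (p.ξ : ℝ) else 1) * (S ⟨p.N, Nat.lt_succ_of_le p.N_le_B⟩).toReal := by
  have hB := p.N_le_B
  have hz := hS.eq_zero_of_lt hη
  rw [p.isSteadyState_iff hη] at hS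
  -- The set tested is `{j | m < j}`. It is entered only from `m`, by an arrival, and left only from
  -- `N`, by a transmission; when `m = 0` a simultaneous arrival puts the buffer at `1`, still
  -- inside.
  have h := hS (fun j => if m < (j : ℕ) then 1 else 0)
  set a : Fin (p.B + 1) := ⟨m, by omega⟩ with ha
  set b : Fin (p.B + 1) := ⟨p.N, Nat.lt_succ_of_le p.N_le_B⟩ with hb
  have key : ∀ i : Fin (p.B + 1),
      (S i).toReal * (p.ξ * (if m < (p.nextEnergy i true true : ℕ) then 1 else 0)
        + (1 - p.ξ) * (if m < (p.nextEnergy i true false : ℕ) then 1 else 0)) =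
      (S i).toReal * (if m < (i : ℕ) then 1 else 0)
        + (if i = a then p.ξ * (S i).toReal else 0)
        - (if i = b then (if m = 0 then 1 - (p.ξ : ℝ) else 1) * (S i).toReal else 0) := by
    intro i
    rcases lt_trichotomy (i : ℕ) p.N with hi | hi | hi
    · have hib : i ≠ b := fun h => by simp [h, hb] at hi
      rw [p.nextEnergy_val_of_lt hi, p.nextEnergy_val_of_lt hi, if_neg hib]
      by_cases hia : i = a
      · subst hia; simp [ha]; ring
      · have : (i : ℕ) ≠ m := fun h => hia (Fin.ext h)
        rw [if_neg hia]
        by_cases hmi : m < (i : ℕ)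
        · simp [hmi, hmi.trans (Nat.lt_succ_self _)]
        · have : ¬ m < (i : ℕ) + 1 := by omega
          simp [hmi, this]
    · have hib : i = b := Fin.ext hi
      have hia : i ≠ a := fun h => by simp [h, ha] at hi; omega
      rw [p.nextEnergy_val_of_le hi.ge, p.nextEnergy_val_of_le hi.ge, if_neg hia, if_pos hib, hi]
      by_cases hm0 : m = 0
      · simp [hm0, p.N_pos]; ring
      · have : ¬ m < 1 := by omega
        simp [hm0, this, hm]
    · have hia : i ≠ a := fun h => by simp [h, ha] at hi; omega
      have hib : i ≠ b := fun h => by simp [h, hb] at hi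
      simp [hz i hi, hia, hib]
  rw [Finset.sum_congr rfl fun i _ => key i, Finset.sum_sub_distrib, Finset.sum_add_distrib,
    Finset.sum_ite_eq', Finset.sum_ite_eq'] at h
  simp only [Finset.mem_univ, if_true] at h
  linarith

/-- The flow balance expresses every `S i` through `S N`, so `S` is proportional to `steady`; both
have total mass one. -/
theorem Params.IsSteadyState.toReal_eq {p : Params} (hη : p.η = 1)
    {S : PMF (Fin (p.B + 1))} (hS : p.IsSteadyState S) (i : Fin (p.B + 1)) :
    (S i).toReal = p.steady i := by
  have hN := p.N_real_pos
  have hξ := p.ξ_real_pos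
  set b : Fin (p.B + 1) := ⟨p.N, Nat.lt_succ_of_le p.N_le_B⟩ with hb
  have hprop : ∀ i : Fin (p.B + 1), p.ξ * (S i).toReal = (p.N * (S b).toReal) * p.steady i := by
    intro i
    rcases lt_trichotomy (i : ℕ) p.N with hi | hi | hi
    · have := hS.flow hη hi
      simp only [Fin.eta] at this
      rw [this, ← hb]
      unfold Params.steady
      split_ifs <;> field_simp
    · have hib : i = b := Fin.ext hi
      have := p.N_pos
      rw [hib]
      unfold Params.steady
      simp only [hb]
      rw [if_neg (by omega), if_neg (by omega)]
      simp only [if_true]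
      field_simp
    · rw [hS.eq_zero_of_lt hη i hi, p.steady_eq_zero hi]; simp
  have hsum : (p.ξ : ℝ) = p.N * (S b).toReal := by
    have := Finset.sum_congr (rfl : Finset.univ = Finset.univ) fun i _ => hprop i
    rwa [← Finset.mul_sum, ← Finset.mul_sum, sum_toReal_pmf, p.sum_steady, mul_one, mul_one] at this
  have := hprop i
  rw [← hsum] at this
  exact mul_left_cancel₀ hξ.ne' this

theorem Params.existsUnique_steadyState (p : Params) (hη : p.η = 1) :
    ∃! S : PMF (Fin (p.B + 1)), p.IsSteadyState S := by
  refine ⟨p.steadyPMF, p.isSteadyState_steadyPMF hη, fun S hS => PMF.ext fun i => ?_⟩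
  rw [← ENNReal.toReal_eq_toReal_iff' (S.apply_ne_top i) (PMF.apply_ne_top _ i),
    hS.toReal_eq hη, p.steadyPMF_toReal]

theorem Params.IsSteadyState.sum_ge {p : Params} (hη : p.η = 1)
    {S : PMF (Fin (p.B + 1))} (hS : p.IsSteadyState S) :
    ∑ i : Fin (p.B + 1), (if p.N ≤ (i : ℕ) then (S i).toReal else 0) = (p.ξ : ℝ) / p.N := by
  have hN := p.N_pos
  rw [Finset.sum_congr rfl fun i _ => by rw [hS.toReal_eq hη],
    p.sum_fin_eq (f := fun i => if p.N ≤ i then p.steady i else 0)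
      fun i hi => by simp [p.steady_eq_zero hi],
    Finset.sum_eq_zero fun i hi => if_neg (by have := Finset.mem_range.1 hi; omega)]
  simp [Params.steady, hN.ne']

theorem Params.IsSteadyState.activity_eq {p : Params} (hη : p.η = 1)
    {S : PMF (Fin (p.B + 1))} (hS : p.IsSteadyState S) : p.activity S = (p.ξ : ℝ) / p.N := by
  rw [Params.activity, hS.sum_ge hη, hη]
  simp

/-! ### Expectations of functions of an i.i.d. history -/

/-- A slot seen by the typical source: energy arrival, and success of a transmission if there is
one. Histories are lists of slots, the latest first. -/
abbrev Mark : Type := Bool × Bool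

/-- Probability of a mark, with arrival probability `ξ` and success probability `q`. -/
def markWeight (ξ q : ℝ) (v : Mark) : ℝ :=
  (if v.1 = true then ξ else 1 - ξ) * (if v.2 = true then q else 1 - q)

/-- Conditional expectation of a function of the history after one more slot. -/
def histStep (ξ q : ℝ) (F : List Mark → ℝ) (l : List Mark) : ℝ :=
  ∑ v : Mark, markWeight ξ q v * F (v :: l)

/-- Expectation of a function of the history after `t` slots. -/
def histExp (ξ q : ℝ) : ℕ → (List Mark → ℝ) → ℝ
  | 0, F => F []
  | t + 1, F => histExp ξ q t (histStep ξ q F)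

section histExp

variable {ξ q : ℝ}

theorem markWeight_nonneg (hξ : 0 ≤ ξ) (hξ1 : ξ ≤ 1) (hq : 0 ≤ q) (hq1 : q ≤ 1) (v : Mark) :
    0 ≤ markWeight ξ q v := by
  unfold markWeight
  apply mul_nonneg <;> split_ifs <;> linarith

theorem histStep_eq (F : List Mark → ℝ) (l : List Mark) :
    histStep ξ q F l = ξ * q * F ((true, true) :: l) + ξ * (1 - q) * F ((true, false) :: l)
      + (1 - ξ) * q * F ((false, true) :: l) + (1 - ξ) * (1 - q) * F ((false, false) :: l) := by
  simp [histStep, markWeight, Fintype.sum_prod_type]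
  ring

theorem histExp_add (t : ℕ) (F G : List Mark → ℝ) :
    histExp ξ q t (fun l => F l + G l) = histExp ξ q t F + histExp ξ q t G := by
  induction t generalizing F G with
  | zero => rfl
  | succ t ih =>
    simp only [histExp]
    rw [← ih]
    congr 1
    funext l
    simp only [histStep_eq]
    ring

theorem histExp_const_mul (t : ℕ) (c : ℝ) (F : List Mark → ℝ) :
    histExp ξ q t (fun l => c * F l) = c * histExp ξ q t F := by
  induction t generalizing F with
  | zero => rfl
  | succ t ih =>
    simp only [histExp]
    rw [← ih]
    congr 1
    funext l
    simp only [histStep_eq]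
    ring

theorem histExp_const (t : ℕ) (c : ℝ) : histExp ξ q t (fun _ => c) = c := by
  induction t with
  | zero => rfl
  | succ t ih =>
    simp only [histExp]
    conv_rhs => rw [← ih]
    congr 1
    funext l
    simp only [histStep_eq]
    ring

theorem histExp_sum {ι : Type*} (s : Finset ι) (t : ℕ) (F : ι → List Mark → ℝ) :
    histExp ξ q t (fun l => ∑ i ∈ s, F i l) = ∑ i ∈ s, histExp ξ q t (F i) := by
  classical
  induction s using Finset.induction_on with
  | empty => simp [histExp_const]
  | insert i s hi ih => simp only [Finset.sum_insert hi, histExp_add, ih]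

theorem histExp_mono (hξ : 0 ≤ ξ) (hξ1 : ξ ≤ 1) (hq : 0 ≤ q) (hq1 : q ≤ 1) (t : ℕ)
    {F G : List Mark → ℝ} (h : ∀ l, F l ≤ G l) : histExp ξ q t F ≤ histExp ξ q t G := by
  induction t generalizing F G with
  | zero => exact h _
  | succ t ih =>
    exact ih fun l => Finset.sum_le_sum fun v _ =>
      mul_le_mul_of_nonneg_left (h _) (markWeight_nonneg hξ hξ1 hq hq1 v)

end histExp

/-! ### Random histories and their expectations. -/

/-- The history of the first `t` slots. -/
def history {Ω : Type*} (w : ℕ → Ω → Mark) : ℕ → Ω → List Mark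
  | 0, _ => []
  | t + 1, ω => w t ω :: history w t ω

/-- A history of `t` slots is a function of finitely many finite-valued marks. Measurability,
boundedness and independence of the next mark all follow from this factorization. -/
theorem exists_history_eq {Ω : Type*} (w : ℕ → Ω → Mark) (t : ℕ) :
    ∃ ψ : (Finset.range t → Mark) → List Mark, ∀ ω, history w t ω = ψ (fun i => w i ω) := by
  induction t with
  | zero => exact ⟨fun _ => [], fun _ => rfl⟩
  | succ t ih =>
    obtain ⟨ψ, hψ⟩ := ih
    refine ⟨fun z => z ⟨t, Finset.self_mem_range_succ t⟩ :: ψ fun i => z ⟨i, ?_⟩, fun ω => ?_⟩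
    · exact Finset.mem_range.2 ((Finset.mem_range.1 i.2).trans (Nat.lt_succ_self t))
    · rw [history, hψ]

/-- The marks of the slots are independent, with law given by `markWeight`. -/
structure IsMarkSequence {Ω : Type*} [MeasurableSpace Ω] (P : Measure Ω) (w : ℕ → Ω → Mark)
    (ξ q : ℝ) : Prop where
  measurable : ∀ t, Measurable (w t)
  indep : iIndepFun w P
  law : ∀ t v, P.real (w t ⁻¹' {v}) = markWeight ξ q v

section history

variable {Ω : Type*} [MeasurableSpace Ω] {P : Measure Ω} {w : ℕ → Ω → Mark} {ξ q : ℝ}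

theorem IsMarkSequence.measurable_history_comp (hw : IsMarkSequence P w ξ q) (t : ℕ)
    (F : List Mark → ℝ) : Measurable fun ω => F (history w t ω) := by
  obtain ⟨ψ, hψ⟩ := exists_history_eq w t
  simp only [hψ]
  have h1 : Measurable fun ω (i : Finset.range t) => w i ω :=
    measurable_pi_lambda _ fun i => hw.measurable i
  have h2 : Measurable fun z => F (ψ z) := measurable_of_finite _
  exact h2.comp h1

theorem IsMarkSequence.integrable_history_comp (hw : IsMarkSequence P w ξ q) (t : ℕ)
    (F : List Mark → ℝ) : Integrable (fun ω => F (history w t ω)) P := by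
  have := hw.indep.isProbabilityMeasure
  obtain ⟨ψ, hψ⟩ := exists_history_eq w t
  have hm := hw.measurable_history_comp t F
  obtain ⟨C, hC⟩ := (Set.finite_range fun z => ‖F (ψ z)‖).bddAbove
  refine Integrable.of_bound hm.aestronglyMeasurable C (ae_of_all _ fun ω => ?_)
  rw [hψ]
  exact hC ⟨_, rfl⟩

/-- Conditioning on the latest mark, which is independent of the earlier history, gives one
application of `histStep`. All later moment estimates can thus be made by the finite recursion
`histExp`. -/
theorem IsMarkSequence.integral_history_comp (hw : IsMarkSequence P w ξ q) (t : ℕ)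
    (F : List Mark → ℝ) : ∫ ω, F (history w t ω) ∂P = histExp ξ q t F := by
  have := hw.indep.isProbabilityMeasure
  induction t generalizing F with
  | zero => simp [history, histExp]
  | succ t ih =>
    have hsplit : ∀ ω, F (history w (t + 1) ω) = ∑ v : Mark,
        (w t ⁻¹' {v}).indicator (fun _ => (1 : ℝ)) ω * F (v :: history w t ω) := by
      intro ω
      rw [Finset.sum_eq_single (w t ω)]
      · simp [history]
      · intro v _ hv
        have : ω ∉ w t ⁻¹' {v} := fun h => hv h.symm
        simp [this]
      · simp
    have hind : ∀ v : Mark, IndepFun (fun ω => (w t ⁻¹' {v}).indicator (fun _ => (1 : ℝ)) ω)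
        (fun ω => F (v :: history w t ω)) P := by
      intro v
      obtain ⟨ψ, hψ⟩ := exists_history_eq w t
      have h := (hw.indep.indepFun_finset {t} (Finset.range t) (by simp) hw.measurable).comp
        (φ := fun z => Set.indicator {v} (fun _ => (1 : ℝ)) (z ⟨t, Finset.mem_singleton_self t⟩))
        (ψ := fun z => F (v :: ψ z)) (measurable_of_finite _) (measurable_of_finite _)
      convert! h using 1
      funext ω
      simp [hψ]
    have hset : ∀ v : Mark, MeasurableSet (w t ⁻¹' {v}) := fun v =>
      hw.measurable t (measurableSet_singleton v)
    have hi1 : ∀ v : Mark, Integrable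
        (fun ω => (w t ⁻¹' {v}).indicator (fun _ => (1 : ℝ)) ω) P :=
      fun v => (integrable_const _).indicator (hset v)
    have hi2 := fun v : Mark => hw.integrable_history_comp t fun l => F (v :: l)
    have hi3 : ∀ v : Mark, Integrable (fun ω => (w t ⁻¹' {v}).indicator (fun _ => (1 : ℝ)) ω *
        F (v :: history w t ω)) P := fun v => (hind v).integrable_mul (hi1 v) (hi2 v)
    simp only [hsplit]
    rw [integral_finsetSum _ fun v _ => hi3 v]
    have hterm : ∀ v : Mark, ∫ ω, (w t ⁻¹' {v}).indicator (fun _ => (1 : ℝ)) ω *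
        F (v :: history w t ω) ∂P = markWeight ξ q v * histExp ξ q t fun l => F (v :: l) := by
      intro v
      rw [(hind v).integral_fun_mul_eq_mul_integral (hi1 v).aestronglyMeasurable
        (hi2 v).aestronglyMeasurable, ih fun l => F (v :: l), ← hw.law t v]
      congr 1
      exact integral_indicator_one (hset v)
    simp only [hterm, histExp]
    unfold histStep
    rw [histExp_sum]
    simp only [histExp_const_mul]

end history

/-! ### The chain of energy and age -/

/-- Energy stored by the typical source after a given history. -/
def histEnergy (N : ℕ) : List Mark → ℕ
  | [] => 0
  | v :: l => (if histEnergy N l = N then 0 else histEnergy N l) + (if v.1 = true then 1 else 0)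

/-- Age of the typical link after a given history. -/
def histAge (N : ℕ) : List Mark → ℕ
  | [] => 0
  | v :: l => if histEnergy N l = N ∧ v.2 = true then 1 else histAge N l + 1

theorem histEnergy_le {N : ℕ} (hN : 0 < N) (l : List Mark) : histEnergy N l ≤ N := by
  induction l with
  | nil => exact Nat.zero_le _
  | cons v l ih =>
    simp only [histEnergy]
    split_ifs <;> omega

section moments

variable {N : ℕ} {ξ q : ℝ}

theorem histStep_energy_age_of_lt (F : ℕ → ℕ → ℝ) {l : List Mark} (hl : histEnergy N l < N) :
    histStep ξ q (fun l => F (histEnergy N l) (histAge N l)) l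
      = ξ * F (histEnergy N l + 1) (histAge N l + 1)
        + (1 - ξ) * F (histEnergy N l) (histAge N l + 1) := by
  simp [histStep_eq, histEnergy, histAge, hl.ne]
  ring

theorem histStep_energy_age_of_eq (F : ℕ → ℕ → ℝ) {l : List Mark} (hl : histEnergy N l = N) :
    histStep ξ q (fun l => F (histEnergy N l) (histAge N l)) l
      = q * (ξ * F 1 1 + (1 - ξ) * F 0 1)
        + (1 - q) * (ξ * F 1 (histAge N l + 1) + (1 - ξ) * F 0 (histAge N l + 1)) := by
  simp [histStep_eq, histEnergy, histAge, hl]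
  ring

/-- The second moment of the age is bounded. -/
theorem exists_histExp_age_sq_le (hN : 0 < N) (hξ : 0 < ξ) (hξ1 : ξ ≤ 1) (hq : 0 < q)
    (hq1 : q ≤ 1) : ∃ K, ∀ t, histExp ξ q t (fun l => (histAge N l : ℝ) ^ 2) ≤ K := by
  have hNr : (1 : ℝ) ≤ N := by exact_mod_cast hN
  -- The Lyapunov function is `W e a = (1 - δe) a²`. The weight drops by `δ` with each unit gained,
  -- so `W` contracts on average while charging. At a transmission the weight returns from `1 - q/4`
  -- to at most `1`, a loss outweighed by the reset of the age with probability `q`.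
  set δ : ℝ := q / (4 * N) with hδ
  have hδN : δ * N = q / 4 := by rw [hδ]; field_simp
  have hδ0 : 0 < δ := by positivity
  have hδ1 : δ ≤ q / 4 := by rw [← hδN]; exact le_mul_of_one_le_right hδ0.le hNr
  set β : ℕ → ℝ := fun e => 1 - δ * e with hβ
  have hβ1 : ∀ e, β e ≤ 1 := fun e => by
    have : 0 ≤ δ * e := by positivity
    simp only [hβ]; linarith
  have hβ0 : ∀ e ≤ N, 3 / 4 ≤ β e := fun e he => by
    have : δ * e ≤ δ * N := by gcongr
    simp only [hβ]; linarith
  set κ : ℝ := ξ * δ with hκ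
  have hκ0 : 0 < κ := by positivity
  have hκδ : κ ≤ δ := mul_le_of_le_one_left hδ0.le hξ1
  set W : ℕ → ℕ → ℝ := fun e a => β e * (a : ℝ) ^ 2 with hW
  set K' : ℝ := 2 + 2 / κ with hK'
  have hK'0 : 0 < K' := by positivity
  -- Half of the contraction absorbs the linear term of `(a + 1)²`, by `2a ≤ κa²/2 + 2/κ`.
  have habs : ∀ a : ℝ, (1 - κ) * (a + 1) ^ 2 ≤ (1 - κ / 2) * a ^ 2 + (1 + 2 / κ) - κ * (2 * a + 1) := by
    intro a
    have h1 : 0 ≤ κ / 2 * (a - 2 / κ) ^ 2 := by positivity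
    have h2 : κ / 2 * (a - 2 / κ) ^ 2 = κ / 2 * a ^ 2 - 2 * a + 2 / κ := by field_simp; ring
    nlinarith
  have hdrift : ∀ l, histStep ξ q (fun l => W (histEnergy N l) (histAge N l)) l ≤
      (1 - κ / 2) * W (histEnergy N l) (histAge N l) + K' := by
    intro l
    set a : ℝ := (histAge N l : ℝ) with ha
    have ha0 : 0 ≤ a := Nat.cast_nonneg _
    have hmain : histStep ξ q (fun l => W (histEnergy N l) (histAge N l)) l ≤
        (1 - κ) * β (histEnergy N l) * (a + 1) ^ 2 + 1 := by
      have hsq : 0 ≤ (a + 1) ^ 2 := sq_nonneg _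
      rcases (histEnergy_le hN l).lt_or_eq with hl | hl
      · rw [histStep_energy_age_of_lt W hl]
        simp only [hW, hβ]
        push_cast
        rw [← ha]
        have h1 : ξ * ((1 - δ * (histEnergy N l + 1)) * (a + 1) ^ 2)
            + (1 - ξ) * ((1 - δ * histEnergy N l) * (a + 1) ^ 2)
            = (1 - δ * histEnergy N l - κ) * (a + 1) ^ 2 := by rw [hκ]; ring
        rw [h1]
        have h2 : 1 - δ * histEnergy N l - κ ≤ (1 - κ) * (1 - δ * histEnergy N l) := by
          have : 0 ≤ κ * (δ * histEnergy N l) := by positivity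
          linarith
        have := mul_le_mul_of_nonneg_right h2 hsq
        linarith
      · rw [histStep_energy_age_of_eq W hl, hl]
        simp only [hW, hβ]
        push_cast
        rw [← ha, hδN]
        have h1 : ξ * ((1 - δ * 1) * (a + 1) ^ 2) + (1 - ξ) * ((1 - δ * 0) * (a + 1) ^ 2)
            ≤ (a + 1) ^ 2 := by
          have : 0 ≤ κ * (a + 1) ^ 2 := by positivity
          rw [hκ] at this
          linarith
        have h2 : q * (ξ * ((1 - δ * 1) * 1 ^ 2) + (1 - ξ) * ((1 - δ * 0) * 1 ^ 2)) ≤ 1 := by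
          have h3 : ξ * ((1 - δ * 1) * 1 ^ 2) + (1 - ξ) * ((1 - δ * 0) * 1 ^ 2) = 1 - κ := by
            rw [hκ]; ring
          rw [h3]
          calc q * (1 - κ) ≤ 1 * 1 := mul_le_mul hq1 (by linarith) (by linarith) zero_le_one
            _ = 1 := one_mul 1
        have h3 : (1 - q) * (ξ * ((1 - δ * 1) * (a + 1) ^ 2)
            + (1 - ξ) * ((1 - δ * 0) * (a + 1) ^ 2)) ≤ (1 - q) * (a + 1) ^ 2 :=
          mul_le_mul_of_nonneg_left h1 (by linarith)
        -- As `κ ≤ δ ≤ q/4`, the right-hand side is at least `(1 - q/4)² ≥ 1 - q/2`.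
        have h4 : 1 - q ≤ (1 - κ) * (1 - q / 4) := by nlinarith
        have := mul_le_mul_of_nonneg_right h4 hsq
        linarith
    have hb1 := hβ1 (histEnergy N l)
    have hb0 := hβ0 _ (histEnergy_le hN l)
    refine hmain.trans ?_
    have h5 := mul_le_mul_of_nonneg_left (habs a) (by linarith : 0 ≤ β (histEnergy N l))
    have h6 : β (histEnergy N l) * (1 + 2 / κ) ≤ 1 * (1 + 2 / κ) :=
      mul_le_mul_of_nonneg_right hb1 (by positivity)
    have h7 : 0 ≤ β (histEnergy N l) * (κ * (2 * a + 1)) := by positivity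
    simp only [hW, ← ha, hK']
    linarith
  -- The bound `2K'/κ` is the fixed point of `x ↦ (1 - κ/2) x + K'`.
  have hbound : ∀ t, histExp ξ q t (fun l => W (histEnergy N l) (histAge N l)) ≤ 2 * K' / κ := by
    intro t
    induction t with
    | zero => simp [histExp, hW, histAge]; positivity
    | succ t ih =>
      have h1 := histExp_mono hξ.le hξ1 hq.le hq1 t hdrift
      rw [histExp_add, histExp_const_mul, histExp_const] at h1
      refine h1.trans ?_
      have h2 : (1 - κ / 2) * histExp ξ q t (fun l => W (histEnergy N l) (histAge N l)) ≤
          (1 - κ / 2) * (2 * K' / κ) := mul_le_mul_of_nonneg_left ih (by linarith)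
      have h3 : (1 - κ / 2) * (2 * K' / κ) + K' = 2 * K' / κ := by field_simp; ring
      linarith
  refine ⟨4 / 3 * (2 * K' / κ), fun t => ?_⟩
  refine le_trans ?_ (mul_le_mul_of_nonneg_left (hbound t) (by norm_num))
  rw [← histExp_const_mul]
  refine histExp_mono hξ.le hξ1 hq.le hq1 t fun l => ?_
  have := mul_le_mul_of_nonneg_right (hβ0 _ (histEnergy_le hN l)) (sq_nonneg (histAge N l : ℝ))
  simp only [hW]
  linarith

/-- Sum of a function of energy and age over the slots of a history. -/
def histSum (N : ℕ) (f : ℕ → ℕ → ℝ) : List Mark → ℝ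
  | [] => 0
  | _ :: l => histSum N f l + f (histEnergy N l) (histAge N l)

/-- If `V` solves the Poisson equation for `f - D` and grows at most linearly in the age, then the
sum of `f - D` over `t` slots has a second moment of order `t`. -/
theorem exists_histExp_sq_le (hN : 0 < N) (hξ : 0 < ξ) (hξ1 : ξ ≤ 1) (hq : 0 < q) (hq1 : q ≤ 1)
    {f V : ℕ → ℕ → ℝ} {D C : ℝ}
    (hV : ∀ e ≤ N, ∀ a : ℕ, |V e a| ≤ C * (1 + a))
    (hP : ∀ l, f (histEnergy N l) (histAge N l) - D
      + histStep ξ q (fun l => V (histEnergy N l) (histAge N l)) l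
        = V (histEnergy N l) (histAge N l)) :
    ∃ K, ∀ t, histExp ξ q t (fun l => (histSum N (fun e a => f e a - D) l) ^ 2) ≤ K * (t + 1) := by
  obtain ⟨K, hK⟩ := exists_histExp_age_sq_le hN hξ hξ1 hq hq1
  have hK0 : 0 ≤ K := (by simp [histExp, histAge] : (0 : ℝ) ≤ _).trans (hK 0)
  have hmono := fun t {F G : List Mark → ℝ} =>
    histExp_mono (F := F) (G := G) hξ.le hξ1 hq.le hq1 t
  have hC : 0 ≤ C := by
    have := (abs_nonneg _).trans (hV 0 (Nat.zero_le _) 0)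
    simpa using this
  set v : List Mark → ℝ := fun l => V (histEnergy N l) (histAge N l) with hv
  set G : List Mark → ℝ := histSum N (fun e a => f e a - D) with hG
  -- By the Poisson equation `M` is a martingale: `histSum` adds the state held before the slot, so
  -- the new value of `G` is already known and only `v` is random.
  set M : List Mark → ℝ := fun l => G l + v l with hM
  have hvb : ∀ l, |v l| ≤ C * (1 + histAge N l) := fun l => hV _ (histEnergy_le hN l) _
  have hsqv : ∀ l, v l ^ 2 ≤ 2 * C ^ 2 * (1 + (histAge N l : ℝ) ^ 2) := fun l => by
    have h1 := pow_le_pow_left₀ (abs_nonneg _) (hvb l) 2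
    rw [sq_abs] at h1
    have : (C * (1 + (histAge N l : ℝ))) ^ 2 ≤ 2 * C ^ 2 * (1 + (histAge N l : ℝ) ^ 2) := by
      have := mul_nonneg (sq_nonneg C) (sq_nonneg (1 - (histAge N l : ℝ)))
      nlinarith
    linarith
  have hage : ∀ (m : Mark) l, (histAge N (m :: l) : ℝ) ^ 2 ≤ 2 + 2 * (histAge N l : ℝ) ^ 2 := by
    intro m l
    simp only [histAge]
    split_ifs
    · have := sq_nonneg (histAge N l : ℝ)
      norm_num
      linarith
    · push_cast
      have := sq_nonneg ((histAge N l : ℝ) - 1)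
      linarith
  have hstep : ∀ l, histStep ξ q (fun l => M l ^ 2) l ≤
      M l ^ 2 + 2 * C ^ 2 * (3 + 2 * (histAge N l : ℝ) ^ 2) := by
    intro l
    have hp := hP l
    set c : ℝ := G l + (f (histEnergy N l) (histAge N l) - D) with hc
    have hMc : ∀ m, M (m :: l) = c + v (m :: l) := fun m => by
      simp only [hM, hG, histSum, hc]
    have hMl : M l = c + histStep ξ q v l := by
      have : M l = G l + v l := rfl
      have hp' : _ = v l := hp
      rw [this, hc, ← hp']
      ring
    -- The mean square grows by exactly the conditional variance of `v`, which is at most its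
    -- conditional second moment and so quadratic in the age.
    have e1 : histStep ξ q (fun l => M l ^ 2) l
        = M l ^ 2 + (histStep ξ q (fun l => v l ^ 2) l - (histStep ξ q v l) ^ 2) := by
      rw [hMl, histStep_eq (fun l => M l ^ 2), histStep_eq v, histStep_eq (fun l => v l ^ 2)]
      simp only [hMc]
      ring
    have e2 : histStep ξ q (fun l => v l ^ 2) l ≤
        2 * C ^ 2 * (3 + 2 * (histAge N l : ℝ) ^ 2) := by
      have h1 : ∀ m ∈ (Finset.univ : Finset Mark), markWeight ξ q m * v (m :: l) ^ 2 ≤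
          markWeight ξ q m * (2 * C ^ 2 * (3 + 2 * (histAge N l : ℝ) ^ 2)) := fun m _ => by
        refine mul_le_mul_of_nonneg_left ((hsqv _).trans ?_)
          (markWeight_nonneg hξ.le hξ1 hq.le hq1 m)
        have := hage m l
        exact mul_le_mul_of_nonneg_left (by linarith) (by positivity)
      refine (Finset.sum_le_sum h1).trans (le_of_eq ?_)
      have := histStep_eq (ξ := ξ) (q := q)
        (fun _ => 2 * C ^ 2 * (3 + 2 * (histAge N l : ℝ) ^ 2)) l
      simp only [histStep] at this
      rw [this]
      ring
    have := sq_nonneg (histStep ξ q v l)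
    linarith
  set L : ℝ := 2 * C ^ 2 * (3 + 2 * K) with hL
  have hL0 : 0 ≤ L := by positivity
  have hMt : ∀ t : ℕ, histExp ξ q t (fun l => M l ^ 2) ≤ C ^ 2 + L * t := by
    intro t
    induction t with
    | zero =>
      have := pow_le_pow_left₀ (abs_nonneg _) (hvb []) 2
      rw [sq_abs] at this
      simpa [histExp, hM, hG, histSum, histAge] using this
    | succ t ih =>
      have h1 := hmono t hstep
      rw [histExp_add, histExp_const_mul, histExp_add, histExp_const, histExp_const_mul] at h1
      simp only [histExp]
      have h2 := mul_le_mul_of_nonneg_left (hK t) (by positivity : 0 ≤ 2 * C ^ 2 * 2)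
      push_cast
      rw [hL] at *
      linarith
  refine ⟨2 * (C ^ 2 + L) + 4 * C ^ 2 * (1 + K), fun t => ?_⟩
  have h1 : ∀ l, G l ^ 2 ≤ 2 * M l ^ 2 + 4 * C ^ 2 * (1 + (histAge N l : ℝ) ^ 2) := fun l => by
    have h2 := hsqv l
    have h3 : G l = M l - v l := by simp [hM]
    rw [h3]
    have := sq_nonneg (M l + v l)
    linarith
  have h2 := hmono t h1
  rw [histExp_add, histExp_const_mul, histExp_const_mul, histExp_add, histExp_const] at h2
  have h3 := mul_le_mul_of_nonneg_left (hK t) (by positivity : 0 ≤ 4 * C ^ 2)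
  have h4 := hMt t
  have h5 : 0 ≤ C ^ 2 * (t : ℝ) := by positivity
  have h6 : 0 ≤ C ^ 2 * (1 + K) * (t : ℝ) := by positivity
  nlinarith

end moments

/-! ### Almost sure convergence of time averages. -/

theorem histSum_history {Ω : Type*} (w : ℕ → Ω → Mark) (N : ℕ) (f : ℕ → ℕ → ℝ) (T : ℕ) (ω : Ω) :
    histSum N f (history w T ω) = ∑ t ∈ Finset.range T,
      f (histEnergy N (history w t ω)) (histAge N (history w t ω)) := by
  induction T with
  | zero => rfl
  | succ T ih => rw [Finset.sum_range_succ, ← ih]; rfl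

/-- The sum of all `Y n ^ 2` has finite expectation, hence is almost surely finite, so its terms
tend to zero. -/
theorem ae_tendsto_zero_of_integral_sq_le {Ω : Type*} [MeasurableSpace Ω] {P : Measure Ω}
    {Y : ℕ → Ω → ℝ} (hY : ∀ n, Integrable (fun ω => Y n ω ^ 2) P) {b : ℕ → ℝ} (hb : Summable b)
    (hYb : ∀ n, ∫ ω, Y n ω ^ 2 ∂P ≤ b n) : ∀ᵐ ω ∂P, Tendsto (fun n => Y n ω) atTop (𝓝 0) := by
  have hb0 : ∀ n, 0 ≤ b n := fun n => (integral_nonneg fun ω => sq_nonneg _).trans (hYb n)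
  have h1 : ∫⁻ ω, ∑' n, ENNReal.ofReal (Y n ω ^ 2) ∂P ≠ ⊤ := by
    rw [lintegral_tsum fun n => (hY n).aemeasurable.ennreal_ofReal]
    refine ne_top_of_le_ne_top ?_ (ENNReal.tsum_le_tsum (g := fun n => ENNReal.ofReal (b n))
      fun n => ?_)
    · rw [← ENNReal.ofReal_tsum_of_nonneg hb0 hb]; exact ENNReal.ofReal_ne_top
    · rw [← ofReal_integral_eq_lintegral_ofReal (hY n) (ae_of_all _ fun _ => sq_nonneg _)]
      exact ENNReal.ofReal_le_ofReal (hYb n)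
  have h2 := ae_lt_top' (AEMeasurable.tsum fun n => (hY n).aemeasurable.ennreal_ofReal) h1
  filter_upwards [h2] with ω hω
  have h3 := ENNReal.tendsto_atTop_zero_of_tsum_ne_top hω.ne
  have h4 := (ENNReal.tendsto_toReal ENNReal.zero_ne_top).comp h3
  have h5 : Tendsto (fun n => Y n ω ^ 2) atTop (𝓝 0) := by
    simpa [Function.comp_def, ENNReal.toReal_ofReal (sq_nonneg _)] using h4
  have h6 := h5.sqrt
  simp only [Real.sqrt_sq_eq_abs, Real.sqrt_zero] at h6
  exact (tendsto_zero_iff_abs_tendsto_zero _).2 h6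

theorem tendsto_succ_sq_div_sq : Tendsto (fun n : ℕ => ((n + 1 : ℕ) : ℝ) ^ 2 / (n : ℝ) ^ 2) atTop
    (𝓝 1) := by
  have h : Tendsto (fun n : ℕ => 1 + 1 / (n : ℝ)) atTop (𝓝 (1 + 0)) :=
    tendsto_const_nhds.add tendsto_one_div_atTop_nhds_zero_nat
  have h2 := h.pow 2
  simp only [add_zero, one_pow] at h2
  refine h2.congr' ?_
  filter_upwards [eventually_gt_atTop 0] with n hn
  have : (n : ℝ) ≠ 0 := by positivity
  push_cast
  field_simp

/-- Ergodic theorem for the chain of energy and age, by means of a solution `V` of the Poisson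
equation. -/
theorem IsMarkSequence.tendsto_average {Ω : Type*} [MeasurableSpace Ω] {P : Measure Ω}
    {w : ℕ → Ω → Mark} {ξ q : ℝ} (hw : IsMarkSequence P w ξ q) {N : ℕ} (hN : 0 < N)
    (hξ : 0 < ξ) (hξ1 : ξ ≤ 1) (hq : 0 < q) (hq1 : q ≤ 1) {f V : ℕ → ℕ → ℝ} {D C : ℝ}
    (hf : ∀ e a, 0 ≤ f e a) (hV : ∀ e ≤ N, ∀ a : ℕ, |V e a| ≤ C * (1 + a))
    (hP : ∀ l, f (histEnergy N l) (histAge N l) - D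
      + histStep ξ q (fun l => V (histEnergy N l) (histAge N l)) l
        = V (histEnergy N l) (histAge N l)) :
    ∀ᵐ ω ∂P, Tendsto (fun T : ℕ => (∑ t ∈ Finset.Icc 1 T,
      f (histEnergy N (history w t ω)) (histAge N (history w t ω))) / (T : ℝ)) atTop (𝓝 D) := by
  obtain ⟨K, hK⟩ := exists_histExp_sq_le hN hξ hξ1 hq hq1 hV hP
  have hK0 : 0 ≤ K := by
    have := hK 0
    simp only [histExp, histSum] at this
    norm_num at this
    exact this
  -- Along times `n²` the normalized sum has second moment of order `1/n²`, which is summable; along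
  -- all times it would only be of order `1/T`.
  set Y : ℕ → Ω → ℝ := fun n ω =>
    histSum N (fun e a => f e a - D) (history w (n ^ 2) ω) / ((n : ℝ) ^ 2) with hY
  have hYsq : ∀ n, ∫ ω, Y n ω ^ 2 ∂P ≤ 2 * K * (1 / (n : ℝ) ^ 2) := by
    intro n
    rw [hw.integral_history_comp (n ^ 2)
      fun l => (histSum N (fun e a => f e a - D) l / ((n : ℝ) ^ 2)) ^ 2]
    have e : (fun l => (histSum N (fun e a => f e a - D) l / ((n : ℝ) ^ 2)) ^ 2)
        = fun l => (1 / ((n : ℝ) ^ 2)) ^ 2 * histSum N (fun e a => f e a - D) l ^ 2 := by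
      funext l; ring
    rw [e, histExp_const_mul]
    rcases Nat.eq_zero_or_pos n with hn | hn
    · simp [hn]
    · have hn1 : (1 : ℝ) ≤ (n : ℝ) ^ 2 := one_le_pow₀ (by exact_mod_cast hn)
      refine (mul_le_mul_of_nonneg_left (hK _) (sq_nonneg _)).trans ?_
      push_cast
      have h1 : K * ((n : ℝ) ^ 2 + 1) ≤ K * (2 * (n : ℝ) ^ 2) := by gcongr; linarith
      refine (mul_le_mul_of_nonneg_left h1 (sq_nonneg _)).trans (le_of_eq ?_)
      field_simp
  have hsum : Summable fun n : ℕ => 2 * K * (1 / (n : ℝ) ^ 2) :=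
    (Real.summable_one_div_nat_pow.2 one_lt_two).mul_left _
  have hlim := ae_tendsto_zero_of_integral_sq_le (P := P) (Y := Y)
    (fun n => hw.integrable_history_comp (n ^ 2)
      fun l => (histSum N (fun e a => f e a - D) l / ((n : ℝ) ^ 2)) ^ 2) hsum hYsq
  filter_upwards [hlim] with ω hω
  set g : ℕ → ℝ := fun t => f (histEnergy N (history w t ω)) (histAge N (history w t ω)) with hg
  have hmono : Monotone fun T => ∑ t ∈ Finset.range T, g t :=
    monotone_nat_of_le_succ fun T => by
      rw [Finset.sum_range_succ]; exact le_add_of_nonneg_right (hf _ _)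
  have hsub : Tendsto (fun n : ℕ => (∑ t ∈ Finset.range (n ^ 2), g t) / ((n ^ 2 : ℕ) : ℝ)) atTop
      (𝓝 D) := by
    have := hω.add_const D
    rw [zero_add] at this
    refine this.congr' ?_
    filter_upwards [eventually_gt_atTop 0] with n hn
    have hn' : (n : ℝ) ≠ 0 := by positivity
    simp only [hY, histSum_history, Finset.sum_sub_distrib]
    simp only [Finset.sum_const, Finset.card_range, nsmul_eq_mul, hg]
    push_cast
    field_simp
    ring
  have hmain : Tendsto (fun T : ℕ => (∑ t ∈ Finset.range T, g t) / (T : ℝ)) atTop (𝓝 D) := by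
    -- Between consecutive squares the monotone partial sums are squeezed, because `(n+1)²/n² → 1`.
    refine tendsto_div_of_monotone_of_exists_subseq_tendsto_div _ D hmono fun a ha =>
      ⟨fun n => n ^ 2, ?_, tendsto_pow_atTop two_ne_zero, hsub⟩
    filter_upwards [tendsto_succ_sq_div_sq.eventually (ge_mem_nhds ha), eventually_gt_atTop 0]
      with n hn hn0
    rw [div_le_iff₀ (by positivity)] at hn
    push_cast at hn ⊢
    exact hn
  have hshift : Tendsto (fun T : ℕ => ((∑ t ∈ Finset.range (T + 1), g t) / ((T + 1 : ℕ) : ℝ))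
      * (1 + 1 / (T : ℝ)) - g 0 * (1 / (T : ℝ))) atTop (𝓝 (D * (1 + 0) - g 0 * 0)) :=
    ((hmain.comp (tendsto_add_atTop_nat 1)).mul (tendsto_const_nhds.add
      tendsto_one_div_atTop_nhds_zero_nat)).sub
      (tendsto_const_nhds.mul tendsto_one_div_atTop_nhds_zero_nat)
  simp only [add_zero, mul_one, mul_zero, sub_zero] at hshift
  refine hshift.congr' ?_
  filter_upwards [eventually_gt_atTop 0] with T hT
  have hT' : (T : ℝ) ≠ 0 := by positivity
  have hs : ∑ t ∈ Finset.range (T + 1), g t = g 0 + ∑ t ∈ Finset.Icc 1 T, g t := by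
    rw [Finset.range_eq_Ico, Finset.sum_eq_sum_Ico_succ_bot (by omega)]
    rfl
  rw [hs]
  push_cast
  field_simp
  ring

/-- The long-run frequency of the slots in which the buffer holds `N` energy units. -/
theorem IsMarkSequence.tendsto_frequency {Ω : Type*} [MeasurableSpace Ω] {P : Measure Ω}
    {w : ℕ → Ω → Mark} {ξ q : ℝ} (hw : IsMarkSequence P w ξ q) {N : ℕ} (hN : 0 < N)
    (hξ : 0 < ξ) (hξ1 : ξ ≤ 1) (hq : 0 < q) (hq1 : q ≤ 1) :
    ∀ᵐ ω ∂P, Tendsto (fun T : ℕ => (∑ t ∈ Finset.Icc 1 T,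
      if histEnergy N (history w t ω) = N then (1 : ℝ) else 0) / (T : ℝ)) atTop (𝓝 (ξ / N)) := by
  have hNr : (0 : ℝ) < N := by exact_mod_cast hN
  -- `V = e/N` works: energy rises by `ξ` per slot on average and a transmission consumes `N`.
  refine hw.tendsto_average hN hξ hξ1 hq hq1 (f := fun e _ => if e = N then (1 : ℝ) else 0)
    (V := fun e _ => (e : ℝ) / N) (C := 1) (fun e a => by positivity) ?_ ?_
  · intro e he a
    have h1 : (e : ℝ) / N ≤ 1 := (div_le_one hNr).2 (by exact_mod_cast he)
    have h2 : (0 : ℝ) ≤ (e : ℝ) / N := by positivity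
    rw [abs_of_nonneg h2]
    have : (0 : ℝ) ≤ a := Nat.cast_nonneg a
    linarith
  · intro l
    rcases (histEnergy_le hN l).lt_or_eq with hl | hl
    · rw [histStep_energy_age_of_lt (fun e _ => (e : ℝ) / N) hl, if_neg hl.ne]
      push_cast
      field_simp
      ring
    · rw [histStep_energy_age_of_eq (fun e _ => (e : ℝ) / N) hl, if_pos hl, hl]
      push_cast
      field_simp
      ring

/-- The long-run average of the age. -/
theorem IsMarkSequence.tendsto_average_age {Ω : Type*} [MeasurableSpace Ω] {P : Measure Ω}
    {w : ℕ → Ω → Mark} {ξ q : ℝ} (hw : IsMarkSequence P w ξ q) {N : ℕ} (hN : 0 < N)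
    (hξ : 0 < ξ) (hξ1 : ξ ≤ 1) (hq : 0 < q) (hq1 : q ≤ 1) :
    ∀ᵐ ω ∂P, Tendsto (fun T : ℕ => (∑ t ∈ Finset.Icc 1 T,
      (histAge N (history w t ω) : ℝ)) / (T : ℝ)) atTop
        (𝓝 (N / (ξ * q) - (N - 1) / (2 * ξ))) := by
  have hNr : (0 : ℝ) < N := by exact_mod_cast hN
  set D : ℝ := N / (ξ * q) - (N - 1) / (2 * ξ) with hD
  -- The ansatz is `V = a m(e) + c(e)`. Matching coefficients of `a`, `m(e)` is the mean number of
  -- slots until a reception starting from energy `e`, with `m₀ = m(N)`. Below `N` the constant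
  -- terms give `ξ (c(e+1) - c(e)) = D + 1 - m(e)`, summed here from `c(0) = 0`; the equation at `e
  -- = N` then fixes `D`.
  set m₀ : ℝ := 1 + (1 - q) * N / (ξ * q) with hm₀
  set m : ℝ → ℝ := fun e => (N - e) / ξ + m₀ with hm
  set c : ℝ → ℝ := fun e => (e * (D + 1 - m₀) - (e * N - e * (e - 1) / 2) / ξ) / ξ with hc
  obtain ⟨C, hC⟩ := ((Set.finite_Iic N).image fun e : ℕ => |m e| + |c e|).bddAbove
  refine hw.tendsto_average hN hξ hξ1 hq hq1 (f := fun _ a => (a : ℝ))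
    (V := fun e a => a * m e + c e) (C := C) (fun e a => Nat.cast_nonneg a) ?_ ?_
  · intro e he a
    have h1 : |m e| + |c e| ≤ C := hC ⟨e, he, rfl⟩
    have ha : (0 : ℝ) ≤ a := Nat.cast_nonneg a
    have h2 := abs_add_le ((a : ℝ) * m e) (c e)
    rw [abs_mul, abs_of_nonneg ha] at h2
    have h3 := mul_le_mul_of_nonneg_right h1 (by linarith : (0 : ℝ) ≤ 1 + a)
    have := mul_nonneg ha (abs_nonneg (c e))
    have := abs_nonneg (m e)
    linarith
  · intro l
    rcases (histEnergy_le hN l).lt_or_eq with hl | hl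
    · rw [histStep_energy_age_of_lt (fun e a => (a : ℝ) * m e + c e) hl]
      simp only [hm, hc]
      push_cast
      field_simp
      ring
    · rw [histStep_energy_age_of_eq (fun e a => (a : ℝ) * m e + c e) hl, hl]
      simp only [hm, hc, hD, hm₀]
      push_cast
      field_simp
      ring

/-! ### The probability generating functional of a Poisson point process -/

/-- The product of `1 + g` over the points `y 0, y 1, …`. -/
def prodOneAdd (g : Plane → ENNReal) (y : ℕ → Plane) : ENNReal :=
  ⨆ n : ℕ, ∏ j ∈ Finset.range n, (1 + g (y j))

theorem monotone_prod_one_add (g : Plane → ENNReal) (y : ℕ → Plane) :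
    Monotone fun n : ℕ => ∏ j ∈ Finset.range n, (1 + g (y j)) :=
  monotone_nat_of_le_succ fun n => by
    rw [Finset.prod_range_succ]
    exact le_mul_of_one_le_right' le_self_add

theorem tendsto_prodOneAdd (g : Plane → ENNReal) (y : ℕ → Plane) :
    Tendsto (fun n : ℕ => ∏ j ∈ Finset.range n, (1 + g (y j))) atTop (𝓝 (prodOneAdd g y)) :=
  tendsto_atTop_iSup (monotone_prod_one_add g y)

theorem prodOneAdd_mono {g g' : Plane → ENNReal} (h : g ≤ g') (y : ℕ → Plane) :
    prodOneAdd g y ≤ prodOneAdd g' y :=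
  iSup_mono fun _ => Finset.prod_le_prod' fun j _ => add_le_add_right (h (y j)) 1

theorem measurable_prodOneAdd {Ω : Type*} [MeasurableSpace Ω] {g : Plane → ENNReal}
    (hg : Measurable g) {x : ℕ → Ω → Plane} (hx : ∀ i, Measurable (x i)) :
    Measurable fun ω => prodOneAdd g fun i => x i ω :=
  Measurable.iSup fun _ => Finset.measurable_fun_prod _ fun j _ =>
    measurable_const.add (hg.comp (hx j))

theorem prodOneAdd_iSup {G : ℕ → Plane → ENNReal} (hG : Monotone G) (y : ℕ → Plane) :
    prodOneAdd (fun z => ⨆ n, G n z) y = ⨆ n, prodOneAdd (G n) y := by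
  have h1 : ∀ k : ℕ, Tendsto (fun n => ∏ j ∈ Finset.range k, (1 + G n (y j))) atTop
      (𝓝 (∏ j ∈ Finset.range k, (1 + ⨆ n, G n (y j)))) := by
    intro k
    induction k with
    | zero => simp
    | succ k ih =>
      simp only [Finset.prod_range_succ]
      refine ENNReal.Tendsto.mul ih (.inl ?_) ?_ (.inl ?_)
      · exact Finset.prod_ne_zero_iff.2 fun j _ => by simp
      · exact tendsto_const_nhds.add (tendsto_atTop_iSup fun a b hab => hG hab _)
      · simp
  have h2 : ∀ k : ℕ, ∏ j ∈ Finset.range k, (1 + ⨆ n, G n (y j))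
      = ⨆ n, ∏ j ∈ Finset.range k, (1 + G n (y j)) := fun k =>
    tendsto_nhds_unique (h1 k) (tendsto_atTop_iSup fun a b hab =>
      Finset.prod_le_prod' fun j _ => add_le_add_right (hG hab _) 1)
  simp only [prodOneAdd, h2]
  exact iSup_comm

theorem lintegral_pow_poissonMeasure (r : NNReal) {c : ENNReal} (hc : c ≠ ⊤) :
    ∫⁻ n, (1 + c) ^ n ∂(poissonMeasure r) = ENNReal.ofReal (Real.exp (r * c.toReal)) := by
  lift c to NNReal using hc
  rw [lintegral_countable']
  have h : ∀ n : ℕ, (1 + (c : ENNReal)) ^ n * poissonMeasure r {n} =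
      ENNReal.ofReal (Real.exp (-r) * ((r * (1 + c)) ^ n / (n.factorial : ℝ))) := by
    intro n
    have e : (1 + (c : ENNReal)) ^ n = ENNReal.ofReal ((1 + c) ^ n) := by
      rw [ENNReal.ofReal_pow (by positivity), ENNReal.ofReal_add zero_le_one c.coe_nonneg]
      simp
    rw [poissonMeasure_singleton, e, ← ENNReal.ofReal_mul (by positivity), mul_pow]
    congr 1
    ring
  simp only [h]
  have hs := (NormedSpace.expSeries_div_hasSum_exp ((r : ℝ) * (1 + c))).mul_left (Real.exp (-r))
  rw [← ENNReal.ofReal_tsum_of_nonneg (fun n => by positivity) hs.summable, hs.tsum_eq,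
    ← Real.exp_eq_exp_ℝ, ← Real.exp_add]
  congr 2
  simp
  ring

theorem measurable_pointCount {Ω : Type*} [MeasurableSpace Ω] {x : ℕ → Ω → Plane}
    (hx : ∀ i, Measurable (x i)) {A : Set Plane} (hA : MeasurableSet A) :
    Measurable fun ω => pointCount (fun i => x i ω) A :=
  measurable_encard.comp (measurable_set_iff.2 fun i => measurableSet_setOfPred.1 (hx i hA))

/-- Only finitely many indices fall in `A`, and past the last of them the partial products no longer
change. -/
theorem prod_indicator_eq_pow (A : Set Plane) (c : ENNReal) {y : ℕ → Plane}
    (h : pointCount y A ≠ ⊤) : ∀ᶠ n in atTop,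
      ∏ j ∈ Finset.range n, (1 + A.indicator (fun _ => c) (y j))
        = (1 + c) ^ (pointCount y A).toNat := by
  classical
  have hfin : {i | y i ∈ A}.Finite := Set.encard_ne_top_iff.1 h
  obtain ⟨b, hb⟩ := hfin.bddAbove
  filter_upwards [eventually_gt_atTop b] with n hn
  have h1 : ∀ j, 1 + A.indicator (fun _ => c) (y j) = if y j ∈ A then 1 + c else 1 := fun j => by
    by_cases hj : y j ∈ A <;> simp [hj]
  simp only [h1, Finset.prod_ite, Finset.prod_const, one_pow, mul_one]
  congr 1
  rw [pointCount, ← Set.ncard_def, Set.ncard_eq_toFinset_card _ hfin]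
  congr 1
  ext j
  simp only [Finset.mem_filter, Finset.mem_range, Set.Finite.mem_toFinset, Set.mem_ofPred_eq]
  exact ⟨fun h => h.2, fun h => ⟨(hb h).trans_lt hn, h⟩⟩

theorem one_add_sum_indicator {n : ℕ} {A : Fin n → Set Plane}
    (hd : Pairwise fun m m' => Disjoint (A m) (A m')) (c : Fin n → ENNReal) (z : Plane) :
    1 + ∑ m, (A m).indicator (fun _ => c m) z = ∏ m, (1 + (A m).indicator (fun _ => c m) z) := by
  by_cases h : ∃ m, z ∈ A m
  · obtain ⟨m, hm⟩ := h
    have h0 : ∀ m', m' ≠ m → (A m').indicator (fun _ => c m') z = 0 := fun m' hm' =>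
      Set.indicator_of_notMem (fun hz => (hd hm').le_bot ⟨hz, hm⟩) _
    rw [Finset.sum_eq_single m (fun m' _ hm' => h0 m' hm') (by simp),
      Finset.prod_eq_single m (fun m' _ hm' => by rw [h0 m' hm', add_zero]) (by simp)]
  · push Not at h
    simp [Set.indicator_of_notMem (h _)]

section PGFL

variable {Ω : Type*} [MeasurableSpace Ω] {μ : Measure Ω}
  {x : ℕ → Ω → Plane} {lam : ℝ}

theorem IsHomogeneousPPP.ae_pointCount_ne_top (hx : IsHomogeneousPPP μ x lam) {A : Set Plane}
    (hA : MeasurableSet A) (hfin : volume A ≠ ⊤) :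
    ∀ᵐ ω ∂μ, pointCount (fun i => x i ω) A ≠ ⊤ := by
  have hm := measurable_pointCount hx.measurable hA
  rw [← ae_map_iff (p := fun k => k ≠ ⊤) hm.aemeasurable .of_discrete, hx.count_law A hA hfin,
    ae_map_iff (Measurable.of_discrete).aemeasurable .of_discrete]
  exact ae_of_all _ fun n => ENat.natCast_ne_top n

theorem IsHomogeneousPPP.lintegral_pow_pointCount (hx : IsHomogeneousPPP μ x lam)
    (hlam : 0 ≤ lam) {A : Set Plane} (hA : MeasurableSet A) (hfin : volume A ≠ ⊤) {c : ENNReal}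
    (hc : c ≠ ⊤) : ∫⁻ ω, (1 + c) ^ (pointCount (fun i => x i ω) A).toNat ∂μ =
      ENNReal.ofReal (Real.exp (lam * (volume A * c).toReal)) := by
  have hm := measurable_pointCount hx.measurable hA
  rw [← lintegral_map (f := fun k : ℕ∞ => (1 + c) ^ k.toNat) .of_discrete hm,
    hx.count_law A hA hfin, lintegral_map .of_discrete .of_discrete]
  simp only [ENat.toNat_natCast]
  rw [lintegral_pow_poissonMeasure _ hc, Real.coe_toNNReal _ (by positivity), ENNReal.toReal_mul,
    mul_assoc]

/-- On disjoint sets the product splits into powers `(1 + c m) ^ count`. The counts are independent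
and Poisson, so the generating functions multiply. -/
theorem IsHomogeneousPPP.lintegral_prodOneAdd_sum_indicator (hx : IsHomogeneousPPP μ x lam)
    (hlam : 0 ≤ lam) {n : ℕ} {A : Fin n → Set Plane} (hA : ∀ m, MeasurableSet (A m))
    (hfin : ∀ m, volume (A m) ≠ ⊤) (hd : Pairwise fun m m' => Disjoint (A m) (A m'))
    {c : Fin n → ENNReal} (hc : ∀ m, c m ≠ ⊤) :
    ∫⁻ ω, prodOneAdd (fun z => ∑ m, (A m).indicator (fun _ => c m) z) (fun i => x i ω) ∂μ =
      ENNReal.ofReal (Real.exp (lam * (∑ m, volume (A m) * c m).toReal)) := by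
  have h1 : ∀ᵐ ω ∂μ, prodOneAdd (fun z => ∑ m, (A m).indicator (fun _ => c m) z)
      (fun i => x i ω) = ∏ m, (1 + c m) ^ (pointCount (fun i => x i ω) (A m)).toNat := by
    have := ae_all_iff.2 fun m => hx.ae_pointCount_ne_top (hA m) (hfin m)
    filter_upwards [this] with ω hω
    refine tendsto_nhds_unique (tendsto_prodOneAdd _ _) (tendsto_const_nhds.congr' ?_)
    filter_upwards [eventually_all.2 fun m => prod_indicator_eq_pow (A m) (c m) (hω m)] with k hk
    simp only [one_add_sum_indicator hd]
    rw [Finset.prod_comm]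
    exact Finset.prod_congr rfl fun m _ => (hk m).symm
  rw [lintegral_congr_ae h1]
  have h2 := (hx.count_indep n A hA hfin hd).comp (fun m k => (1 + c m) ^ (ENat.toNat k))
    fun m => .of_discrete
  have h3 := lintegral_prod_eq_prod_lintegral_of_indepFun Finset.univ _ h2 fun m =>
    Measurable.of_discrete.comp (measurable_pointCount hx.measurable (hA m))
  refine h3.trans ?_
  simp only [Function.comp_def, hx.lintegral_pow_pointCount hlam (hA _) (hfin _) (hc _)]
  rw [← ENNReal.ofReal_prod_of_nonneg fun m _ => (Real.exp_pos _).le, ← Real.exp_sum,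
    ← Finset.mul_sum, ENNReal.toReal_sum fun m _ => ENNReal.mul_ne_top (hfin m) (hc m)]

theorem IsHomogeneousPPP.lintegral_prodOneAdd_simpleFunc (hx : IsHomogeneousPPP μ x lam)
    (hlam : 0 ≤ lam) (φ : SimpleFunc Plane ENNReal) (htop : ∀ z, φ z ≠ ⊤)
    (hfin : volume (Function.support φ) ≠ ⊤) :
    ∫⁻ ω, prodOneAdd φ (fun i => x i ω) ∂μ =
      ENNReal.ofReal (Real.exp (lam * (∫⁻ z, φ z).toReal)) := by
  classical
  -- The value `0` is discarded, since its level set has infinite area; the others lie in the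
  -- support.
  set s := φ.range.filter (· ≠ 0) with hs
  set c : Fin s.card → ENNReal := fun m => (s.equivFin.symm m : ENNReal) with hc
  have hsum : ∀ F : ENNReal → ENNReal, ∑ m, F (c m) = ∑ v ∈ s, F v := fun F => by
    rw [← Finset.sum_coe_sort s F]
    exact Equiv.sum_comp s.equivFin.symm fun v : s => F v
  have hcs : ∀ m, c m ∈ s := fun m => (s.equivFin.symm m).2
  have hφ : (φ : Plane → ENNReal)
      = fun z => ∑ m, (φ ⁻¹' {c m}).indicator (fun _ => c m) z := by
    funext z
    rw [hsum fun v => (φ ⁻¹' {v}).indicator (fun _ => v) z]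
    by_cases hz : φ z = 0
    · rw [hz, Finset.sum_eq_zero fun v hv => Set.indicator_of_notMem (fun h => ?_) _]
      rw [Set.mem_preimage, hz] at h
      exact (Finset.mem_filter.1 hv).2 h.symm
    · rw [Finset.sum_eq_single (φ z)]
      · simp
      · intro v _ hv
        exact Set.indicator_of_notMem (fun h => hv h.symm) _
      · intro h
        exact absurd (Finset.mem_filter.2 ⟨φ.mem_range_self z, hz⟩) h
  have hint : ∫⁻ z, φ z = ∑ m, volume (φ ⁻¹' {c m}) * c m := by
    rw [φ.lintegral_eq_lintegral, SimpleFunc.lintegral, hsum fun v => volume (φ ⁻¹' {v}) * v,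
      hs, Finset.sum_filter]
    refine Finset.sum_congr rfl fun v _ => ?_
    by_cases hv : v = 0 <;> simp [hv, mul_comm]
  rw [hint, ← hx.lintegral_prodOneAdd_sum_indicator hlam (fun m => φ.measurableSet_preimage _)
    (fun m => ?_) (fun m m' h => ?_) (fun m => ?_), ← hφ]
  · refine ne_top_of_le_ne_top hfin (measure_mono fun z hz => ?_)
    rw [Set.mem_preimage] at hz
    rw [Function.mem_support, hz]
    exact (Finset.mem_filter.1 (hcs m)).2
  · refine Disjoint.preimage _ (Set.disjoint_singleton.2 fun h' => h ?_)
    exact s.equivFin.symm.injective (Subtype.ext h')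
  · obtain ⟨z, hz⟩ := SimpleFunc.mem_range.1 (Finset.mem_filter.1 (hcs m)).1
    rw [← hz]
    exact htop z

/-- The probability generating functional of a homogeneous Poisson point process, at functions
larger than one. -/
theorem IsHomogeneousPPP.lintegral_prodOneAdd (hx : IsHomogeneousPPP μ x lam) (hlam : 0 ≤ lam)
    {g : Plane → ENNReal} (hg : Measurable g) (hfin : ∫⁻ z, g z ≠ ⊤) :
    ∫⁻ ω, prodOneAdd g (fun i => x i ω) ∂μ =
      ENNReal.ofReal (Real.exp (lam * (∫⁻ z, g z).toReal)) := by
  set φ : ℕ → SimpleFunc Plane ENNReal := SimpleFunc.eapprox g with hφ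
  have hmono : Monotone fun n => (φ n : Plane → ENNReal) :=
    fun a b hab => SimpleFunc.monotone_eapprox g hab
  have hg' : g = fun z => ⨆ n, φ n z := funext fun z => (SimpleFunc.iSup_eapprox_apply hg z).symm
  have h1 : ∀ ω, prodOneAdd g (fun i => x i ω) = ⨆ n, prodOneAdd (φ n) (fun i => x i ω) := by
    intro ω
    conv_lhs => rw [hg']
    exact prodOneAdd_iSup hmono _
  simp only [h1]
  rw [lintegral_iSup (fun n => measurable_prodOneAdd (φ n).measurable hx.measurable)
    fun a b hab ω => prodOneAdd_mono (hmono hab) _]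
  have h2 : ∀ n, ∫⁻ ω, prodOneAdd (φ n) (fun i => x i ω) ∂μ =
      ENNReal.ofReal (Real.exp (lam * (∫⁻ z, φ n z).toReal)) := fun n =>
    -- The approximants `eapprox` take finite values, and their supports have finite area because
    -- `g` is integrable.
    hx.lintegral_prodOneAdd_simpleFunc hlam (φ n)
      (fun z => (SimpleFunc.eapprox_lt_top g n z).ne)
      (measure_support_eapprox_lt_top hg hfin n).ne
  have h3 : Tendsto (fun n => ∫⁻ z, φ n z) atTop (𝓝 (∫⁻ z, g z)) := by
    conv_rhs => rw [hg', lintegral_iSup (fun n => (φ n).measurable) hmono]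
    exact tendsto_atTop_iSup fun a b hab => lintegral_mono (hmono hab)
  have h4 := ENNReal.tendsto_ofReal ((Real.continuous_exp.tendsto _).comp
    (((ENNReal.tendsto_toReal hfin).comp h3).const_mul lam))
  refine tendsto_nhds_unique (tendsto_atTop_iSup fun a b hab => ?_) (h4.congr fun n => ?_)
  · exact lintegral_mono fun ω => prodOneAdd_mono (hmono hab) _
  · rw [h2 n]; rfl

end PGFL

/-! ### An integral over the plane -/

/-- Writing `1/s` as the integral of `exp(-st)` over `t > 0` and exchanging the integrals leaves
`Γ(2/α) Γ(1 - 2/α)`, which the reflection formula evaluates. -/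
theorem lintegral_id_div_one_add_rpow {α b : ℝ} (hα : 2 < α) (hb : 0 < b) :
    ∫⁻ ρ in Set.Ioi (0 : ℝ), ENNReal.ofReal (ρ / (1 + ρ ^ α / b)) =
      ENNReal.ofReal (b ^ (2 / α) / α * (Real.pi / Real.sin (Real.pi * (2 / α)))) := by
  have hα0 : 0 < α := by linarith
  have h2α : 2 / α < 1 := (div_lt_one hα0).2 hα
  have h2α0 : 0 < 2 / α := by positivity
  have hinner : ∀ ρ ∈ Set.Ioi (0 : ℝ), ENNReal.ofReal (ρ / (1 + ρ ^ α / b)) =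
      ∫⁻ t in Set.Ioi (0 : ℝ), ENNReal.ofReal (ρ * Real.exp (-(1 + ρ ^ α / b) * t)) := by
    intro ρ hρ
    have hρ' : (0 : ℝ) < ρ := hρ
    have hs : 0 < 1 + ρ ^ α / b := by positivity
    rw [← ofReal_integral_eq_lintegral_ofReal
      ((integrableOn_exp_mul_Ioi (neg_neg_of_pos hs) 0).const_mul ρ)
      (ae_of_all _ fun t => by positivity), integral_const_mul,
      integral_exp_mul_Ioi (neg_neg_of_pos hs)]
    rw [mul_zero, Real.exp_zero, neg_div_neg_eq, mul_one_div]
  have houter : ∀ t ∈ Set.Ioi (0 : ℝ),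
      ∫⁻ ρ in Set.Ioi (0 : ℝ), ENNReal.ofReal (ρ * Real.exp (-(1 + ρ ^ α / b) * t)) =
        ENNReal.ofReal (b ^ (2 / α) / α * Real.Gamma (2 / α)
          * (Real.exp (-t) * t ^ ((1 - 2 / α) - 1))) := by
    intro t ht
    have ht' : (0 : ℝ) < t := ht
    have htb : 0 < t / b := by positivity
    have e : ∀ ρ ∈ Set.Ioi (0 : ℝ), ρ * Real.exp (-(1 + ρ ^ α / b) * t) =
        Real.exp (-t) * (ρ ^ (1 : ℝ) * Real.exp (-(t / b) * ρ ^ α)) := by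
      intro ρ _
      rw [Real.rpow_one, mul_left_comm, ← Real.exp_add]
      congr 2
      ring
    have hval : ∫ ρ in Set.Ioi (0 : ℝ), ρ * Real.exp (-(1 + ρ ^ α / b) * t) =
        b ^ (2 / α) / α * Real.Gamma (2 / α) * (Real.exp (-t) * t ^ ((1 - 2 / α) - 1)) := by
      rw [setIntegral_congr_fun measurableSet_Ioi e, integral_const_mul,
        integral_rpow_mul_exp_neg_mul_rpow hα0 (by norm_num) htb,
        Real.div_rpow ht'.le hb.le]
      have e1 : (-((1 : ℝ) + 1) / α) = -(2 / α) := by ring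
      have e2 : ((1 : ℝ) + 1) / α = 2 / α := by ring
      have e3 : (1 - 2 / α) - 1 = -(2 / α) := by ring
      rw [e1, e2, e3, Real.rpow_neg hb.le]
      field_simp
    have hpos : 0 < b ^ (2 / α) / α * Real.Gamma (2 / α)
        * (Real.exp (-t) * t ^ ((1 - 2 / α) - 1)) := by
      have := Real.Gamma_pos_of_pos h2α0
      positivity
    rw [← hval, ofReal_integral_eq_lintegral_ofReal]
    -- A non-integrable function would have Bochner integral `0`, but the value found is positive.
    · by_contra h
      rw [integral_undef h] at hval
      exact hpos.ne hval
    · filter_upwards [ae_restrict_mem measurableSet_Ioi] with ρ hρ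
      have : (0 : ℝ) < ρ := hρ
      positivity
  rw [setLIntegral_congr_fun measurableSet_Ioi hinner, lintegral_lintegral_swap]
  · rw [setLIntegral_congr_fun measurableSet_Ioi houter,
      ← ofReal_integral_eq_lintegral_ofReal, integral_const_mul,
      ← Real.Gamma_eq_integral (by linarith : 0 < 1 - 2 / α), mul_assoc,
      Real.Gamma_mul_Gamma_one_sub]
    · exact (Real.GammaIntegral_convergent (by linarith)).const_mul _
    · filter_upwards [ae_restrict_mem measurableSet_Ioi] with t ht
      have : (0 : ℝ) < t := ht
      have := Real.Gamma_pos_of_pos h2α0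
      positivity
  · apply Measurable.aemeasurable
    fun_prop

/-- Polar coordinates. Nonnegativity is asked only at positive radii, since the origin is a null
set. -/
theorem lintegral_plane_norm {f : ℝ → ℝ} {I : ℝ} (hf0 : ∀ ρ, 0 < ρ → 0 ≤ f ρ)
    (hfm : Measurable f) (hI : 0 ≤ I)
    (h : ∫⁻ ρ in Set.Ioi (0 : ℝ), ENNReal.ofReal (ρ * f ρ) = ENNReal.ofReal I) :
    ∫⁻ z : Plane, ENNReal.ofReal (f ‖z‖) = ENNReal.ofReal (2 * Real.pi * I) := by
  have hnn : 0 ≤ᵐ[volume.restrict (Set.Ioi (0 : ℝ))] fun ρ => ρ * f ρ := by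
    filter_upwards [ae_restrict_mem measurableSet_Ioi] with ρ hρ
    exact mul_nonneg (le_of_lt hρ) (hf0 ρ hρ)
  have hint : IntegrableOn (fun ρ => ρ * f ρ) (Set.Ioi (0 : ℝ)) := by
    refine ⟨(measurable_id.mul hfm).aestronglyMeasurable, ?_⟩
    rw [hasFiniteIntegral_iff_ofReal hnn, h]
    exact ENNReal.ofReal_lt_top
  have hval : ∫ ρ in Set.Ioi (0 : ℝ), ρ * f ρ = I := by
    rw [integral_eq_lintegral_of_nonneg_ae hnn hint.1, h, ENNReal.toReal_ofReal hI]
  have hdim : Module.finrank ℝ Plane = 2 := by simp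
  have hball : (volume : Measure Plane).real (Metric.ball 0 1) = Real.pi := by
    rw [measureReal_def, EuclideanSpace.volume_ball_fin_two]
    simp [Real.pi_nonneg]
  have hint2 : Integrable (fun z : Plane => f ‖z‖) := by
    rw [integrable_fun_norm_addHaar volume, hdim]
    simpa using hint
  have hval2 : ∫ z : Plane, f ‖z‖ = 2 * Real.pi * I := by
    rw [integral_fun_norm_addHaar volume f, hdim, hball]
    simp [hval, mul_assoc]
  rw [← hval2, ofReal_integral_eq_lintegral_ofReal hint2]
  have h0 : ∀ᵐ z : Plane, z ≠ 0 := by simp [ae_iff]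
  filter_upwards [h0] with z hz
  exact hf0 _ (norm_pos_iff.2 hz)

/-- The exponent of the generating functional for the interference. -/
theorem lintegral_plane_interference {α A q : ℝ} (hα : 2 < α) (hA : 0 < A) (hq : 0 < q)
    (hq1 : q < 1) :
    ∫⁻ z : Plane, ENNReal.ofReal (q * (A * ‖z‖ ^ (-α)) / (1 + (1 - q) * (A * ‖z‖ ^ (-α)))) =
      ENNReal.ofReal (Real.pi * A ^ (2 / α) / Real.sinc (Real.pi * (2 / α))
        * q / (1 - q) ^ (1 - 2 / α)) := by
  have hα0 : 0 < α := by linarith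
  have h2α : 2 / α < 1 := (div_lt_one hα0).2 hα
  have h2α0 : 0 < 2 / α := by positivity
  have hq' : 0 < 1 - q := by linarith
  have hb : 0 < (1 - q) * A := by positivity
  have hsin : 0 < Real.sin (Real.pi * (2 / α)) := by
    apply Real.sin_pos_of_pos_of_lt_pi
    · have := Real.pi_pos; positivity
    · exact mul_lt_of_lt_one_right Real.pi_pos h2α
  have hpi := Real.pi_pos
  set J := ((1 - q) * A) ^ (2 / α) / α * (Real.pi / Real.sin (Real.pi * (2 / α))) with hJ
  have hJ0 : 0 ≤ J := by positivity
  -- Multiplying numerator and denominator by `ρ^α/((1-q)A)` turns the radial integrand into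
  -- `q/(1-q)` times the one above, with `b = (1-q)A`.
  rw [lintegral_plane_norm (f := fun ρ => q * (A * ρ ^ (-α)) / (1 + (1 - q) * (A * ρ ^ (-α))))
    (I := q / (1 - q) * J) (fun ρ hρ => by positivity) (by fun_prop) (by positivity)]
  · congr 1
    rw [hJ, Real.sinc_of_ne_zero (by positivity), Real.mul_rpow hq'.le hA.le,
      Real.rpow_sub hq', Real.rpow_one]
    field_simp
  · rw [ENNReal.ofReal_mul (by positivity), hJ, ← lintegral_id_div_one_add_rpow hα hb,
      ← lintegral_const_mul _ (by fun_prop)]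
    refine setLIntegral_congr_fun measurableSet_Ioi fun ρ hρ => ?_
    have hρ' : (0 : ℝ) < ρ := hρ
    have : 0 < ρ ^ α := by positivity
    rw [← ENNReal.ofReal_mul (by positivity), Real.rpow_neg hρ'.le]
    congr 1
    field_simp
    ring

/-! ### Laplace transforms -/

/-- The function `exp (-a)` on `[0, ∞]`, with value `0` at infinity. -/
def negExp (a : ENNReal) : ENNReal := EReal.exp (-(a : EReal))

theorem continuous_negExp : Continuous negExp :=
  (EReal.expOrderIso.continuous).comp (continuous_neg.comp continuous_coe_ennreal_ereal)

theorem negExp_ofReal {x : ℝ} (hx : 0 ≤ x) :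
    negExp (ENNReal.ofReal x) = ENNReal.ofReal (Real.exp (-x)) := by
  rw [negExp, EReal.coe_ennreal_ofReal, max_eq_left hx, ← EReal.coe_neg, EReal.exp_coe]

@[simp] theorem negExp_top : negExp ⊤ = 0 := by simp [negExp]

@[simp] theorem negExp_zero : negExp 0 = 1 := by simp [negExp]

theorem negExp_le_one (a : ENNReal) : negExp a ≤ 1 := by
  rw [negExp, EReal.exp_le_one_iff, EReal.neg_le, neg_zero]
  exact EReal.coe_ennreal_nonneg a

theorem negExp_add (a b : ENNReal) : negExp (a + b) = negExp a * negExp b := by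
  simp only [negExp]
  rw [EReal.coe_ennreal_add, EReal.neg_add (.inl (EReal.coe_ennreal_ne_bot _))
    (.inr (EReal.coe_ennreal_ne_bot _)), sub_eq_add_neg, EReal.exp_add]

theorem negExp_sum {ι : Type*} (s : Finset ι) (a : ι → ENNReal) :
    negExp (∑ i ∈ s, a i) = ∏ i ∈ s, negExp (a i) := by
  classical
  induction s using Finset.induction_on with
  | empty => simp
  | insert i s hi ih => rw [Finset.sum_insert hi, Finset.prod_insert hi, negExp_add, ih]

theorem expMeasure_Ioi {x : ℝ} (hx : 0 ≤ x) :
    expMeasure 1 (Set.Ioi x) = ENNReal.ofReal (Real.exp (-x)) := by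
  have := isProbabilityMeasure_expMeasure one_pos
  have h := cdf_expMeasure_eq one_pos x
  rw [if_pos hx, one_mul, cdf_eq_real] at h
  rw [← Set.compl_Iic, ← ofReal_measureReal, probReal_compl_eq_one_sub measurableSet_Iic, h,
    sub_sub_cancel]

/-- Tilting the unit exponential density by `exp(-sh)` gives `1/(1+s)` times the exponential density
of rate `1 + s`. -/
theorem lintegral_negExp_expMeasure {s : ℝ} (hs : 0 ≤ s) :
    ∫⁻ h, negExp (ENNReal.ofReal (s * h)) ∂(expMeasure 1) = ENNReal.ofReal (1 / (1 + s)) := by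
  have hd : expMeasure 1 = volume.withDensity (exponentialPDF 1) := rfl
  have hs1 : 0 < 1 + s := by linarith
  have hm : ∀ r, Measurable (exponentialPDF r) := fun r =>
    (measurable_exponentialPDFReal r).ennreal_ofReal
  have hmF : Measurable fun h : ℝ => negExp (ENNReal.ofReal (s * h)) :=
    continuous_negExp.measurable.comp (by fun_prop)
  rw [hd, lintegral_withDensity_eq_lintegral_mul _ (hm 1) hmF]
  have : ∀ h, (exponentialPDF 1 * fun h => negExp (ENNReal.ofReal (s * h))) h =
      ENNReal.ofReal (1 / (1 + s)) * exponentialPDF (1 + s) h := by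
    intro h
    rw [Pi.mul_apply]
    rcases lt_or_ge h 0 with hh | hh
    · rw [exponentialPDF_of_neg hh, exponentialPDF_of_neg hh, zero_mul, mul_zero]
    · rw [exponentialPDF_of_nonneg hh, exponentialPDF_of_nonneg hh, negExp_ofReal (by positivity),
        ← ENNReal.ofReal_mul (by positivity), ← ENNReal.ofReal_mul (by positivity)]
      congr 1
      rw [← mul_assoc, one_div_mul_cancel hs1.ne', one_mul, one_mul, ← Real.exp_add]
      ring_nf
  simp only [this]
  rw [lintegral_const_mul _ (hm _), lintegral_exponentialPDF_eq_one hs1, mul_one]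

/-! ### Success probability given the positions of the nodes -/

open Classical in
/-- Interference caused by a source at `z`. -/
def Params.interferenceTerm (p : Params) (z : Plane) (w : InterfererSlot p.B) : ENNReal :=
  if p.N ≤ (w.2.1 : ℕ) ∧ w.2.2 = true then
    ENNReal.ofReal (p.P * w.1 * ‖z‖ ^ (-p.α)) else 0

theorem Params.measurable_interferenceTerm (p : Params) (z : Plane) :
    Measurable (p.interferenceTerm z) := by
  refine Measurable.ite ?_ (by fun_prop) measurable_const
  exact measurable_snd (MeasurableSet.of_discrete
    (s := {v : Fin (p.B + 1) × Bool | p.N ≤ (v.1 : ℕ) ∧ v.2 = true}))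

theorem Params.measurable_interference (p : Params) (y : ℕ → Plane) :
    Measurable (p.interference y) :=
  Measurable.tsum fun j => (p.measurable_interferenceTerm (y j)).comp (measurable_pi_apply j)

/-- The factor `θ r^α / P` turning received power into the exponent of a Laplace transform. -/
def Params.laplaceArg (p : Params) (θ : ℝ) : ℝ := θ * p.r ^ p.α / p.P

theorem Params.laplaceArg_pos (p : Params) {θ : ℝ} (hθ : 0 < θ) : 0 < p.laplaceArg θ := by
  have := p.r_pos
  have := p.P_pos
  unfold Params.laplaceArg
  positivity

/-- The function of the generating functional for the interference. -/
def Params.interferenceWeight (p : Params) (θ : ℝ) (z : Plane) : ENNReal :=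
  ENNReal.ofReal (p.ξ / p.N * (θ * p.r ^ p.α * ‖z‖ ^ (-p.α))
    / (1 + (1 - p.ξ / p.N) * (θ * p.r ^ p.α * ‖z‖ ^ (-p.α))))

theorem Params.activity_pos (p : Params) : (0 : ℝ) < p.ξ / p.N :=
  div_pos p.ξ_real_pos p.N_real_pos

theorem Params.activity_lt_one (p : Params) : (p.ξ : ℝ) / p.N < 1 := by
  rw [div_lt_one p.N_real_pos]
  have : (1 : ℝ) ≤ p.N := by exact_mod_cast p.N_pos
  exact p.ξ_real_lt_one.trans_le this

theorem isProbabilityMeasure_exp_one : IsProbabilityMeasure (expMeasure 1) :=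
  isProbabilityMeasure_expMeasure one_pos

attribute [local instance] isProbabilityMeasure_exp_one

instance (p : Params) (S : PMF (Fin (p.B + 1))) : IsProbabilityMeasure (p.interfererLaw S) := by
  unfold Params.interfererLaw
  infer_instance

/-- A source is silent with probability `1 - q` and otherwise contributes `1/(1+s)`, where `q =
ξ/N`. The mixture `(1 + (1-q)s)/(1+s)` is the inverse of `1 + qs/(1 + (1-q)s)`, whence the shape of
`interferenceWeight`. -/
theorem Params.lintegral_negExp_interferenceTerm (p : Params) (hη : p.η = 1)
    {S : PMF (Fin (p.B + 1))} (hS : p.IsSteadyState S) {θ : ℝ} (hθ : 0 < θ) (z : Plane) :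
    ∫⁻ w, negExp (ENNReal.ofReal (p.laplaceArg θ) * p.interferenceTerm z w) ∂(p.interfererLaw S) =
      (1 + p.interferenceWeight θ z)⁻¹ := by
  classical
  have hc := p.laplaceArg_pos hθ
  have hr := p.r_pos
  have hq := p.activity_pos
  have hq1 := p.activity_lt_one
  set q : ℝ := p.ξ / p.N with hqdef
  set s : ℝ := θ * p.r ^ p.α * ‖z‖ ^ (-p.α) with hs
  have hs0 : 0 ≤ s := by positivity
  have hm : Measurable fun w =>
      negExp (ENNReal.ofReal (p.laplaceArg θ) * p.interferenceTerm z w) :=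
    continuous_negExp.measurable.comp ((p.measurable_interferenceTerm z).const_mul _)
  have hterm : ∀ h κ, negExp (ENNReal.ofReal (p.laplaceArg θ) *
      p.interferenceTerm z (h, κ, true)) =
        if p.N ≤ (κ : ℕ) then negExp (ENNReal.ofReal (s * h)) else 1 := by
    intro h κ
    simp only [Params.interferenceTerm, and_true]
    split_ifs with hκ
    · rw [← ENNReal.ofReal_mul hc.le]
      congr 2
      have := p.P_pos
      rw [Params.laplaceArg, hs]
      field_simp
    · simp
  have hint : ∀ κ : Fin (p.B + 1), ∫⁻ h, (if p.N ≤ (κ : ℕ) then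
      negExp (ENNReal.ofReal (s * h)) else 1) ∂(expMeasure 1) =
        ENNReal.ofReal (if p.N ≤ (κ : ℕ) then 1 / (1 + s) else 1) := by
    intro κ
    split_ifs
    · exact lintegral_negExp_expMeasure hs0
    · simp
  have hmκ : ∀ κ : Fin (p.B + 1), Measurable fun h : ℝ => if p.N ≤ (κ : ℕ) then
      negExp (ENNReal.ofReal (s * h)) else 1 := by
    intro κ
    split_ifs
    · exact continuous_negExp.measurable.comp (by fun_prop)
    · exact measurable_const
  rw [Params.interfererLaw, hη, bernoulliMeasure_one, lintegral_prod_symm _ hm.aemeasurable,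
    lintegral_prod _ (hm.lintegral_prod_left').aemeasurable]
  simp only [lintegral_dirac, hterm, hint]
  rw [lintegral_fintype]
  have hsum : ∑ κ : Fin (p.B + 1), (if p.N ≤ (κ : ℕ) then 1 / (1 + s) else 1) * (S κ).toReal
      = (1 + (1 - q) * s) / (1 + s) := by
    have h1 := hS.sum_ge hη
    have h2 := sum_toReal_pmf S
    have e : ∀ κ : Fin (p.B + 1), (if p.N ≤ (κ : ℕ) then 1 / (1 + s) else 1) * (S κ).toReal =
        (S κ).toReal - (1 - 1 / (1 + s)) * (if p.N ≤ (κ : ℕ) then (S κ).toReal else 0) := by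
      intro κ
      split_ifs <;> ring
    rw [Finset.sum_congr rfl fun κ _ => e κ, Finset.sum_sub_distrib, ← Finset.mul_sum, h1, h2,
      ← hqdef]
    field_simp
    ring
  have hlhs : ∑ κ : Fin (p.B + 1), ENNReal.ofReal (if p.N ≤ (κ : ℕ) then 1 / (1 + s) else 1) *
      S.toMeasure {κ} = ENNReal.ofReal ((1 + (1 - q) * s) / (1 + s)) := by
    rw [← hsum, ENNReal.ofReal_sum_of_nonneg fun κ _ => by positivity]
    refine Finset.sum_congr rfl fun κ _ => ?_
    rw [PMF.toMeasure_apply_singleton _ _ (measurableSet_singleton κ),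
      ENNReal.ofReal_mul (by positivity), ENNReal.ofReal_toReal (S.apply_ne_top κ)]
  have hq' : 0 < 1 - q := by linarith
  rw [hlhs, Params.interferenceWeight, ← hqdef, ← hs, ← ENNReal.ofReal_one,
    ← ENNReal.ofReal_add zero_le_one (by positivity), ← ENNReal.ofReal_inv_of_pos (by positivity)]
  congr 1
  field_simp
  ring

/-- The Laplace transform of the interference, given the positions of the nodes. -/
theorem Params.lintegral_negExp_interference (p : Params) (hη : p.η = 1)
    {S : PMF (Fin (p.B + 1))} (hS : p.IsSteadyState S) {θ : ℝ} (hθ : 0 < θ) (y : ℕ → Plane) :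
    ∫⁻ w, negExp (ENNReal.ofReal (p.laplaceArg θ) * p.interference y w)
      ∂(Measure.infinitePi fun _ : ℕ => p.interfererLaw S) =
      (prodOneAdd (p.interferenceWeight θ) y)⁻¹ := by
  set c := ENNReal.ofReal (p.laplaceArg θ) with hc
  set ν := Measure.infinitePi fun _ : ℕ => p.interfererLaw S with hν
  set X : ℕ → (ℕ → InterfererSlot p.B) → ENNReal := fun j w =>
    negExp (c * p.interferenceTerm (y j) (w j)) with hX
  have hmt : ∀ j, Measurable fun w => negExp (c * p.interferenceTerm (y j) w) := fun j =>
    continuous_negExp.measurable.comp ((p.measurable_interferenceTerm (y j)).const_mul _)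
  have hXm : ∀ j, Measurable (X j) := fun j => (hmt j).comp (measurable_pi_apply j)
  have hfin : ∀ n : ℕ, ∫⁻ w, ∏ j ∈ Finset.range n, X j w ∂ν =
      (∏ j ∈ Finset.range n, (1 + p.interferenceWeight θ (y j)))⁻¹ := by
    intro n
    rw [lintegral_prod_eq_prod_lintegral_of_indepFun _ X (iIndepFun_infinitePi hmt) hXm,
      ENNReal.prod_inv_distrib (fun i _ j _ _ => .inl (by simp))]
    refine Finset.prod_congr rfl fun j _ => ?_
    rw [← p.lintegral_negExp_interferenceTerm hη hS hθ (y j)]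
    exact (measurePreserving_eval_infinitePi (fun _ : ℕ => p.interfererLaw S) j).lintegral_comp
      (hmt j)
  -- Partial sums of the interference converge in `[0, ∞]` and `negExp` is continuous there and at
  -- most one. Dominated convergence applies without knowing that the interference is finite.
  have h1 : Tendsto (fun n : ℕ => ∫⁻ w, ∏ j ∈ Finset.range n, X j w ∂ν) atTop
      (𝓝 (∫⁻ w, negExp (c * p.interference y w) ∂ν)) := by
    refine tendsto_lintegral_of_dominated_convergence (fun _ => 1)
      (fun n => Finset.measurable_fun_prod _ fun j _ => hXm j) (fun n => ae_of_all _ fun w => ?_)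
      (by simp) (ae_of_all _ fun w => ?_)
    · exact Finset.prod_le_one' fun j _ => negExp_le_one _
    · simp only [hX, ← negExp_sum, ← Finset.mul_sum]
      refine (continuous_negExp.tendsto _).comp (ENNReal.Tendsto.const_mul ?_
        (.inr ENNReal.ofReal_ne_top))
      exact ENNReal.summable.hasSum.tendsto_sum_nat
  refine tendsto_nhds_unique h1 ?_
  simp only [hfin]
  exact (continuous_inv.tendsto _).comp (tendsto_prodOneAdd _ _)

/-- The randomness of a slot apart from the energy arrival of the typical source. -/
abbrev Rest (B : ℕ) : Type := (Bool × Bool × ℝ) × (ℕ → InterfererSlot B)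

/-- Law of the randomness of a slot apart from the energy arrival of the typical source. -/
def Params.restLaw (p : Params) (S : PMF (Fin (p.B + 1))) : Measure (Rest p.B) :=
  ((bernoulliMeasure true false p.η).prod ((bernoulliMeasure true false
      (⟨1 - p.ε, by linarith [p.ε_lt_one], by linarith [p.ε_pos]⟩ : unitInterval)).prod
        (expMeasure 1))).prod (Measure.infinitePi fun _ : ℕ => p.interfererLaw S)

instance (p : Params) (S : PMF (Fin (p.B + 1))) : IsProbabilityMeasure (p.restLaw S) := by
  unfold Params.restLaw
  infer_instance

instance (p : Params) : IsProbabilityMeasure p.typicalLaw := by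
  unfold Params.typicalLaw
  infer_instance

/-- The decoder succeeds and the SINR exceeds `θ`. -/
def Params.goodSet (p : Params) (y : ℕ → Plane) (θ : ℝ) : Set (Rest p.B) :=
  {z | z.1.2.1 = true ∧ θ < p.sinr y ((false, z.1), z.2)}

theorem Params.measurable_sinr (p : Params) (y : ℕ → Plane) : Measurable (p.sinr y) := by
  unfold Params.sinr
  have := p.measurable_interference y
  fun_prop

theorem Params.measurableSet_goodSet (p : Params) (y : ℕ → Plane) (θ : ℝ) :
    MeasurableSet (p.goodSet y θ) := by
  refine MeasurableSet.inter ?_ ?_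
  · exact (measurable_fst.comp (measurable_snd.comp measurable_fst)) (measurableSet_singleton true)
  · have : Measurable fun z : Rest p.B => p.sinr y ((false, z.1), z.2) :=
      (p.measurable_sinr y).comp (by fun_prop)
    exact measurableSet_lt measurable_const this

/-- The SINR exceeds `θ` exactly if the fading of the typical link is large enough. -/
theorem Params.expMeasure_sinr_gt (p : Params) {θ : ℝ} (hθ : 0 < θ) (I : ENNReal) :
    expMeasure 1 {h | θ < (ENNReal.ofReal (p.P * h * p.r ^ (-p.α))
      / (I + ENNReal.ofReal p.σ2)).toReal} =
      negExp (ENNReal.ofReal (p.laplaceArg θ) * (I + ENNReal.ofReal p.σ2)) := by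
  have hc := p.laplaceArg_pos hθ
  have hr := p.r_pos
  have hP := p.P_pos
  have hσ := p.σ2_pos
  -- Infinite interference gives SINR zero, which is below `θ`, and agrees with `negExp ⊤ = 0`.
  by_cases hI : I = ⊤
  · rw [hI, top_add, ENNReal.mul_top (ENNReal.ofReal_pos.2 hc).ne', negExp_top]
    simp [not_lt.2 hθ.le]
  · lift I to NNReal using hI
    have hI0 : 0 ≤ (I : ℝ) := I.coe_nonneg
    have e : (I : ENNReal) + ENNReal.ofReal p.σ2 = ENNReal.ofReal (I + p.σ2) := by
      rw [ENNReal.ofReal_add I.coe_nonneg hσ.le, ENNReal.ofReal_coe_nnreal]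
    rw [e, ← ENNReal.ofReal_mul hc.le, negExp_ofReal (by positivity),
      ← expMeasure_Ioi (by positivity)]
    congr 1
    ext h
    have hra : 0 < p.r ^ p.α := by positivity
    simp only [Set.mem_ofPred_eq, Set.mem_Ioi]
    rw [← ENNReal.ofReal_div_of_pos (by positivity), ENNReal.toReal_ofReal', lt_max_iff,
      or_iff_left (not_lt.2 hθ.le), lt_div_iff₀ (by positivity), Params.laplaceArg,
      Real.rpow_neg hr.le, ← div_eq_mul_inv, lt_div_iff₀ hra, div_mul_eq_mul_div, div_lt_iff₀ hP]
    constructor <;> intro h' <;> linarith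

/-- Success probability of a transmission, given the positions of the nodes. -/
theorem Params.restLaw_goodSet (p : Params) (hη : p.η = 1) {S : PMF (Fin (p.B + 1))}
    (hS : p.IsSteadyState S) {θ : ℝ} (hθ : 0 < θ) (y : ℕ → Plane) :
    p.restLaw S (p.goodSet y θ) = ENNReal.ofReal ((1 - p.ε)
      * Real.exp (-(p.σ2 * p.r ^ p.α * θ / p.P)))
        * (prodOneAdd (p.interferenceWeight θ) y)⁻¹ := by
  have hc := p.laplaceArg_pos hθ
  have hσ := p.σ2_pos
  have hP := p.P_pos
  have hε := p.ε_lt_one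
  rw [Params.restLaw, Measure.prod_apply_symm (p.measurableSet_goodSet y θ)]
  have hslice : ∀ w : ℕ → InterfererSlot p.B, (fun v => (v, w)) ⁻¹' p.goodSet y θ =
      Set.univ ×ˢ (({true} : Set Bool) ×ˢ {h | θ < (ENNReal.ofReal (p.P * h * p.r ^ (-p.α))
      / (p.interference y w + ENNReal.ofReal p.σ2)).toReal}) := by
    intro w
    ext ⟨u, d, h⟩
    simp [Params.goodSet, Params.sinr]
  simp only [hslice, Measure.prod_prod, measure_univ, one_mul, p.expMeasure_sinr_gt hθ, mul_add,
    negExp_add]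
  rw [bernoulliMeasure_apply_of_mem_of_notMem _ (measurableSet_singleton _) rfl (by simp),
    lintegral_const_mul', lintegral_mul_const', p.lintegral_negExp_interference hη hS hθ,
    ← ENNReal.ofReal_mul hc.le, negExp_ofReal (by positivity), ENNReal.ofReal_mul (by linarith)]
  · have e : p.laplaceArg θ * p.σ2 = p.σ2 * p.r ^ p.α * θ / p.P := by
      rw [Params.laplaceArg]; ring
    rw [e, mul_comm (prodOneAdd _ _)⁻¹, ← mul_assoc]
    congr 2
    rw [ENNReal.ofReal]
    congr 1
    exact (Real.toNNReal_of_nonneg (by linarith)).symm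
  · exact ((negExp_le_one _).trans_lt ENNReal.one_lt_top).ne
  · exact ENNReal.coe_ne_top

/-! ### The typical link -/

theorem Params.measurePreserving_slot (p : Params) (S : PMF (Fin (p.B + 1))) :
    MeasurePreserving (fun w : Slot p.B => (w.1.1, (w.1.2, w.2)))
      (p.typicalLaw.prod (Measure.infinitePi fun _ : ℕ => p.interfererLaw S))
      ((bernoulliMeasure true false p.ξ).prod (p.restLaw S)) :=
  measurePreserving_prodAssoc _ _ _

open Classical in
/-- The mark of slot `t`: energy arrival, and the event `E` concerning the rest of the slot. -/
def slotMark {B : ℕ} (E : Set (Rest B)) (t : ℕ) (s : ℕ → Slot B) : Mark :=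
  ((s t).1.1, decide (((s t).1.2, (s t).2) ∈ E))

theorem Params.isMarkSequence_slotMark (p : Params) (S : PMF (Fin (p.B + 1)))
    {E : Set (Rest p.B)} (hE : MeasurableSet E) :
    IsMarkSequence (p.slotsLaw S) (slotMark E) p.ξ ((p.restLaw S).real E) := by
  classical
  have hdec : Measurable fun z : Rest p.B => decide (z ∈ E) :=
    measurable_to_bool (by
      convert! hE using 1
      ext z
      simp)
  have hm : Measurable fun w : Slot p.B => ((w.1.1, decide ((w.1.2, w.2) ∈ E)) : Mark) :=
    (measurable_fst.comp measurable_fst).prodMk (hdec.comp (by fun_prop))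
  refine ⟨fun t => hm.comp (measurable_pi_apply t), iIndepFun_infinitePi fun _ => hm, ?_⟩
  rintro t ⟨a, g⟩
  have h1 : (p.slotsLaw S).real (slotMark E t ⁻¹' {(a, g)}) =
      ((bernoulliMeasure true false p.ξ).prod (p.restLaw S)).real
        ({a} ×ˢ {z | decide (z ∈ E) = g}) := by
    have hms : MeasurableSet ((fun w : Slot p.B => ((w.1.1, decide ((w.1.2, w.2) ∈ E)) : Mark)) ⁻¹'
        {(a, g)}) := hm (measurableSet_singleton _)
    have hms2 : MeasurableSet (({a} : Set Bool) ×ˢ {z : Rest p.B | decide (z ∈ E) = g}) :=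
      (measurableSet_singleton a).prod (hdec (measurableSet_singleton g))
    rw [measureReal_def, measureReal_def]
    congr 1
    rw [← (p.measurePreserving_slot S).measure_preimage hms2.nullMeasurableSet]
    refine ((measurePreserving_eval_infinitePi (fun _ : ℕ => p.typicalLaw.prod
      (Measure.infinitePi fun _ : ℕ => p.interfererLaw S)) t).measure_preimage
        hms.nullMeasurableSet).trans ?_
    congr 1
    ext w
    simp
  rw [h1, measureReal_prod_prod, markWeight]
  congr 1
  · cases a
    · rw [bernoulliMeasure_real_apply_of_notMem_of_mem _ (measurableSet_singleton _)
        (by simp) rfl]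
      simp
    · rw [bernoulliMeasure_real_apply_of_mem_of_notMem _ (measurableSet_singleton _)
        rfl (by simp)]
      simp
  · cases g
    · have : {z : Rest p.B | decide (z ∈ E) = false} = Eᶜ := by ext z; simp
      rw [this, probReal_compl_eq_one_sub hE]
      simp
    · simp

/-- At update rate one the typical source almost surely always decides to update. -/
theorem Params.ae_update (p : Params) (hη : p.η = 1) (S : PMF (Fin (p.B + 1))) :
    ∀ᵐ s ∂(p.slotsLaw S), ∀ t, (s t).1.2.1 = true := by
  rw [ae_all_iff]
  intro t
  have h0 : ∀ᵐ u ∂(bernoulliMeasure true false p.η), u = true := by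
    rw [hη, bernoulliMeasure_one, ae_dirac_eq]
    rfl
  have h1 : ∀ᵐ v ∂p.typicalLaw, v.2.1 = true :=
    Measure.quasiMeasurePreserving_snd.ae (Measure.quasiMeasurePreserving_fst.ae h0)
  have h2 : ∀ᵐ w ∂p.typicalLaw.prod (Measure.infinitePi fun _ : ℕ => p.interfererLaw S),
      w.1.2.1 = true := Measure.quasiMeasurePreserving_fst.ae h1
  exact (measurePreserving_eval_infinitePi (fun _ : ℕ => p.typicalLaw.prod
    (Measure.infinitePi fun _ : ℕ => p.interfererLaw S)) t).quasiMeasurePreserving.ae h2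

/-- At level `N` a transmission is certain, so the content stays at most `N ≤ B` and the cap never
acts. The event `E` is arbitrary because the energy ignores success. -/
theorem Params.energy_eq_histEnergy (p : Params) (E : Set (Rest p.B)) {s : ℕ → Slot p.B}
    (hs : ∀ t, (s t).1.2.1 = true) (t : ℕ) :
    (p.energy s t : ℕ) = histEnergy p.N (history (slotMark E) t s) := by
  induction t with
  | zero => rfl
  | succ t ih =>
    simp only [Params.energy, history, histEnergy, slotMark]
    rw [← ih, hs t]
    have hle := histEnergy_le p.N_pos (history (slotMark E) t s)
    rw [← ih] at hle
    rcases hle.lt_or_eq with h | h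
    · rw [p.nextEnergy_val_of_lt h, if_neg h.ne]
    · rw [p.nextEnergy_val_of_le h.ge, h]
      simp

theorem Params.attempt_iff (p : Params) (E : Set (Rest p.B)) {s : ℕ → Slot p.B}
    (hs : ∀ t, (s t).1.2.1 = true) (t : ℕ) :
    p.Attempt s t ↔ histEnergy p.N (history (slotMark E) t s) = p.N := by
  have hle := histEnergy_le p.N_pos (history (slotMark E) t s)
  rw [Params.Attempt, p.energy_eq_histEnergy E hs, hs t]
  simp only [and_true]
  omega

theorem Params.sinr_nonneg (p : Params) (y : ℕ → Plane) (w : Slot p.B) : 0 ≤ p.sinr y w :=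
  ENNReal.toReal_nonneg

theorem Params.success_iff (p : Params)
    (hRt : Real.logb 2 p.blocklength / (2 * p.blocklength) < p.Rt)
    {θ : ℝ} (hθ : 0 < θ) (hθR : p.codingRate θ = p.Rt) (y : ℕ → Plane) {s : ℕ → Slot p.B}
    (hs : ∀ t, (s t).1.2.1 = true) (t : ℕ) :
    p.Success y s t ↔ histEnergy p.N (history (slotMark (p.goodSet y θ)) t s) = p.N ∧
      (slotMark (p.goodSet y θ) t s).2 = true := by
  rw [Params.Success, p.attempt_iff (p.goodSet y θ) hs,
    p.lt_codingRate_iff hRt hθ hθR (p.sinr_nonneg y _)]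
  have : (slotMark (p.goodSet y θ) t s).2 = true ↔
      (s t).1.2.2.1 = true ∧ θ < p.sinr y (s t) := by
    simp only [slotMark, decide_eq_true_eq]
    rfl
  rw [this]
  tauto

theorem Params.age_eq_histAge (p : Params)
    (hRt : Real.logb 2 p.blocklength / (2 * p.blocklength) < p.Rt)
    {θ : ℝ} (hθ : 0 < θ) (hθR : p.codingRate θ = p.Rt) (y : ℕ → Plane) {s : ℕ → Slot p.B}
    (hs : ∀ t, (s t).1.2.1 = true) (t : ℕ) :
    p.age y s t = histAge p.N (history (slotMark (p.goodSet y θ)) t s) := by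
  -- Stated additively to avoid truncated subtraction. A packet sent in slot `t` is received at time
  -- `t + 1` with age `1`.
  have h : p.lastGeneration y s t
      + histAge p.N (history (slotMark (p.goodSet y θ)) t s) = t := by
    induction t with
    | zero => rfl
    | succ t ih =>
      simp only [Params.lastGeneration, history, histAge,
        p.success_iff hRt hθ hθR y hs t]
      split_ifs
      · rfl
      · omega
  have h' : (p.lastGeneration y s t : ℝ)
      + histAge p.N (history (slotMark (p.goodSet y θ)) t s) = t := by exact_mod_cast h
  rw [Params.age]
  linarith

theorem Params.isUpdateFrequency (p : Params) (hη : p.η = 1) (S : PMF (Fin (p.B + 1))) :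
    p.IsUpdateFrequency S ((p.ξ : ℝ) / p.N) := by
  classical
  -- Outcomes of transmissions do not affect the energy, so the sure event, with `q = 1`, serves as
  -- the success mark.
  have hw := p.isMarkSequence_slotMark S (E := Set.univ) MeasurableSet.univ
  rw [probReal_univ] at hw
  filter_upwards [p.ae_update hη S, hw.tendsto_frequency p.N_pos p.ξ_real_pos p.ξ_real_lt_one.le
    one_pos le_rfl] with s hs hlim
  refine hlim.congr fun T => ?_
  congr 1
  rw [Finset.card_filter, Nat.cast_sum]
  refine Finset.sum_congr rfl fun t _ => ?_
  simp only [p.attempt_iff Set.univ hs]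
  split_ifs <;> simp

/-- The average age of the typical link, given the positions of the nodes. -/
theorem Params.ae_tendsto_average_age (p : Params) (hη : p.η = 1)
    (hRt : Real.logb 2 p.blocklength / (2 * p.blocklength) < p.Rt)
    {θ : ℝ} (hθ : 0 < θ) (hθR : p.codingRate θ = p.Rt) {S : PMF (Fin (p.B + 1))}
    (hS : p.IsSteadyState S) {y : ℕ → Plane} (hy : prodOneAdd (p.interferenceWeight θ) y ≠ ⊤) :
    ∀ᵐ s ∂(p.slotsLaw S),
      Tendsto (fun T : ℕ => (∑ t ∈ Finset.Icc 1 T, p.age y s t) / (T : ℝ)) atTop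
        (𝓝 (p.N * Real.exp (p.σ2 * p.r ^ p.α * θ / p.P) / (p.ξ * (1 - p.ε))
          * (prodOneAdd (p.interferenceWeight θ) y).toReal - (p.N - 1) / (2 * p.ξ))) := by
  set F := prodOneAdd (p.interferenceWeight θ) y with hF
  have hF1 : 1 ≤ F := le_iSup_of_le (f := fun n : ℕ =>
    ∏ j ∈ Finset.range n, (1 + p.interferenceWeight θ (y j))) 0 (by simp)
  have hF0 : 0 < F.toReal := ENNReal.toReal_pos (zero_lt_one.trans_le hF1).ne' hy
  have hw := p.isMarkSequence_slotMark S (p.measurableSet_goodSet y θ)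
  have hε := p.ε_lt_one
  have hq : (p.restLaw S).real (p.goodSet y θ) =
      (1 - p.ε) * Real.exp (-(p.σ2 * p.r ^ p.α * θ / p.P)) * F.toReal⁻¹ := by
    rw [measureReal_def, p.restLaw_goodSet hη hS hθ, ENNReal.toReal_mul, ENNReal.toReal_ofReal,
      ENNReal.toReal_inv]
    have := Real.exp_pos (-(p.σ2 * p.r ^ p.α * θ / p.P))
    exact mul_nonneg (by linarith) this.le
  have hε' : 0 < 1 - p.ε := by linarith
  have hq0 : 0 < (p.restLaw S).real (p.goodSet y θ) := by rw [hq]; positivity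
  filter_upwards [p.ae_update hη S, hw.tendsto_average_age p.N_pos p.ξ_real_pos
    p.ξ_real_lt_one.le hq0 measureReal_le_one] with s hs hlim
  simp only [p.age_eq_histAge hRt hθ hθR y hs]
  convert! hlim using 3
  rw [hq, Real.exp_neg]
  have := p.ξ_real_pos
  have := Real.exp_pos (p.σ2 * p.r ^ p.α * θ / p.P)
  field_simp

theorem Params.lintegral_interferenceWeight (p : Params) {θ : ℝ} (hθ : 0 < θ) :
    ∫⁻ z, p.interferenceWeight θ z = ENNReal.ofReal (p.bigOmega θ * p.r ^ 2
      * ((p.ξ : ℝ) / p.N) / (1 - (p.ξ : ℝ) / p.N) ^ (1 - 2 / p.α)) := by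
  have hr := p.r_pos
  have hα : p.α ≠ 0 := by linarith [p.two_lt_α]
  have hA : 0 < θ * p.r ^ p.α := by positivity
  refine (lintegral_plane_interference p.two_lt_α hA p.activity_pos p.activity_lt_one).trans ?_
  have e : (θ * p.r ^ p.α) ^ (2 / p.α) = θ ^ (2 / p.α) * p.r ^ 2 := by
    rw [Real.mul_rpow hθ.le (by positivity), ← Real.rpow_mul hr.le, mul_div_cancel₀ _ hα]
    norm_num
  rw [e, Params.bigOmega]
  congr 1
  ring

theorem Params.bigOmega_nonneg (p : Params) {θ : ℝ} (hθ : 0 < θ) : 0 ≤ p.bigOmega θ := by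
  have hα := p.two_lt_α
  have h0 : 0 < 2 / p.α := by positivity
  have h1 : 2 / p.α < 1 := (div_lt_one (by linarith)).2 hα
  have hpi := Real.pi_pos
  have hsin : 0 < Real.sin (Real.pi * (2 / p.α)) :=
    Real.sin_pos_of_pos_of_lt_pi (by positivity) (mul_lt_of_lt_one_right hpi h1)
  rw [Params.bigOmega, Real.sinc_of_ne_zero (by positivity)]
  positivity

theorem Params.isNetworkAverageAoI (p : Params) (hη : p.η = 1)
    (hRt : Real.logb 2 p.blocklength / (2 * p.blocklength) < p.Rt)
    {θ : ℝ} (hθ : 0 < θ) (hθR : p.codingRate θ = p.Rt) {S : PMF (Fin (p.B + 1))}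
    (hS : p.IsSteadyState S) {Ω : Type*} [MeasurableSpace Ω] {μ : Measure Ω}
    [IsProbabilityMeasure μ] {x : ℕ → Ω → Plane} (hx : IsHomogeneousPPP μ x p.lam) :
    p.IsNetworkAverageAoI S μ x
      ((p.N : ℝ) * Real.exp (p.σ2 * p.r ^ p.α * θ / p.P
          + p.lam * p.bigOmega θ * p.r ^ 2 * ((p.ξ : ℝ) / p.N)
            / (1 - (p.ξ : ℝ) / p.N) ^ (1 - 2 / p.α))
        / ((p.ξ : ℝ) * (1 - p.ε))
      - ((p.N : ℝ) - 1) / (2 * (p.ξ : ℝ))) := by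
  have hgm : Measurable (p.interferenceWeight θ) := by
    unfold Params.interferenceWeight
    fun_prop
  have hg := p.lintegral_interferenceWeight hθ
  set F : Ω → ENNReal := fun ω => prodOneAdd (p.interferenceWeight θ) fun i => x i ω with hF
  have hFm : Measurable F := measurable_prodOneAdd hgm hx.measurable
  have hI := hx.lintegral_prodOneAdd p.lam_pos.le hgm (hg ▸ ENNReal.ofReal_ne_top)
  have hq := p.activity_pos
  have hq1 : 0 < 1 - (p.ξ : ℝ) / p.N := sub_pos.2 p.activity_lt_one
  have hΩ := p.bigOmega_nonneg hθ
  rw [hg, ENNReal.toReal_ofReal (by positivity)] at hI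
  have hItop : ∫⁻ ω, F ω ∂μ ≠ ⊤ := by rw [hI]; exact ENNReal.ofReal_ne_top
  -- A finite mean makes `F` finite for almost every configuration, which is the condition for a
  -- positive success probability.
  have hfin := ae_lt_top hFm hItop
  have hint : Integrable (fun ω => (F ω).toReal) μ :=
    integrable_toReal_of_lintegral_ne_top hFm.aemeasurable hItop
  have hval := integral_toReal hFm.aemeasurable hfin
  rw [hI, ENNReal.toReal_ofReal (Real.exp_pos _).le] at hval
  refine ⟨fun ω => p.N * Real.exp (p.σ2 * p.r ^ p.α * θ / p.P) / (p.ξ * (1 - p.ε))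
    * (F ω).toReal - (p.N - 1) / (2 * p.ξ), ?_, ?_, ?_⟩
  · filter_upwards [hfin] with ω hω
    exact p.ae_tendsto_average_age hη hRt hθ hθR hS hω.ne
  · exact (hint.const_mul _).sub (integrable_const _)
  · rw [integral_sub (hint.const_mul _) (integrable_const _), integral_const_mul, hval,
      integral_const, probReal_univ, one_smul, Real.exp_add]
    have e : p.lam * (p.bigOmega θ * p.r ^ 2 * ((p.ξ : ℝ) / p.N)
        / (1 - (p.ξ : ℝ) / p.N) ^ (1 - 2 / p.α)) = p.lam * p.bigOmega θ * p.r ^ 2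
          * ((p.ξ : ℝ) / p.N) / (1 - (p.ξ : ℝ) / p.N) ^ (1 - 2 / p.α) := by ring
    rw [e]
    ring

end EHNetwork

end

theorem mainTheorem6 (p : EHNetwork.Params) (hη : p.η = 1)
    (hRt : Real.logb 2 p.blocklength / (2 * p.blocklength) < p.Rt)
    (θ : ℝ) (hθ : 0 < θ) (hθR : p.codingRate θ = p.Rt)
    {Ω : Type*} [MeasurableSpace Ω] (μ : Measure Ω) [IsProbabilityMeasure μ]
    (x : ℕ → Ω → EHNetwork.Plane) (hx : EHNetwork.IsHomogeneousPPP μ x p.lam) :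
    (∃! S : PMF (Fin (p.B + 1)), p.IsSteadyState S) ∧
    ∀ S : PMF (Fin (p.B + 1)), p.IsSteadyState S →
      (∀ i : Fin (p.B + 1), p.N < (i : ℕ) → S i = 0) ∧
      p.activity S = (p.ξ : ℝ) / p.N ∧
      p.IsUpdateFrequency S ((p.ξ : ℝ) / p.N) ∧
      p.IsNetworkAverageAoI S μ x
        ((p.N : ℝ) * Real.exp (p.σ2 * p.r ^ p.α * θ / p.P
            + p.lam * p.bigOmega θ * p.r ^ 2 * ((p.ξ : ℝ) / p.N)
              / (1 - (p.ξ : ℝ) / p.N) ^ (1 - 2 / p.α))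
          / ((p.ξ : ℝ) * (1 - p.ε))
        - ((p.N : ℝ) - 1) / (2 * (p.ξ : ℝ))) := by
  refine ⟨p.existsUnique_steadyState hη, fun S hS => ⟨fun i hi => ?_, hS.activity_eq hη,
    p.isUpdateFrequency hη S, p.isNetworkAverageAoI hη hRt hθ hθR hS hx⟩⟩
  exact ((ENNReal.toReal_eq_zero_iff _).1 (hS.eq_zero_of_lt hη i hi)).resolve_right
    (S.apply_ne_top i)
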